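/- Let $\mathbb K$ be a field and $V$ a vector space over $\mathbb K$ of finite positive dimension. A *tridiagonal pair* on $V$ is an ordered pair of linear maps $A,A^*:V\to V$ such that (a) $A$ and $A^*$ are diagonalizable; (b) there is an ordering $V_0,\dots,V_d$ of the eigenspaces of $A$ with $A^*V_i\subseteq V_{i-1}+V_i+V_{i+1}$ for $0\le i\le d$ (where $V_{-1}=V_{d+1}=0$); (c) there is an ordering $V^*_0,\dots,V^*_\delta$ of the eigenspaces of $A^*$ with $AV^*_i\subseteq V^*_{i-1}+V^*_i+V^*_{i+1}$ for $0\le i\le\delta$ (where $V^*_{-1}=V^*_{\delta+1}=0$); (d) no subspace $W$ with $0\ne W\ne V$ satisfies $AW\subseteq W$ and $A^*W\subseteq W$. Orderings as in (b), (c) are called standard. A *tridiagonal system* of diameter $d$ is a sequence $(A;\{E_i\}_{i=0}^d;A^*;\{E_i^*\}_{i=0}^d)$ in which $A,A^*$ is a tridiagonal pair, $\{E_iV\}_{i=0}^d$ and $\{E^*_iV\}_{i=0}^d$ are standard orderings of the eigenspaces of $A$ and of $A^*$, and $E_i$ (resp. $E_i^*$) is the projection of $V$ onto $E_iV$ (resp.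 $E_i^*V$) that vanishes on the other eigenspaces of $A$ (resp. $A^*$). Fix such a system with $d\ge1$, and let $\theta_i$ be the eigenvalue of $A$ on $E_iV$. For $0\le i\le j\le d+1$ put $$\tau_{ij}=\prod_{h=i}^{j-1}(x-\theta_h),\qquad \eta_{ij}=\prod_{h=i}^{j-1}(x-\theta_{d-h}),\qquad \tau_j=\tau_{0j},\quad \eta_j=\eta_{0j},$$ and for $0\le i\le d+1$ put $\vartheta_i=\sum_{h=0}^{i-1}\frac{\theta_h-\theta_{d-h}}{\theta_0-\theta_d}$. For $0\le i\le d$ let $$U_i=(E_0^*V+\cdots+E_i^*V)\cap(E_iV+\cdots+E_dV),\qquad U_i^{\Downarrow}=(E_0^*V+\cdots+E_i^*V)\cap(E_0V+\cdots+E_{d-i}V),$$ and for $0\le i\le d/2$ let $K_i=(E_0^*V+\cdots+E_i^*V)\cap(E_iV+\cdots+E_{d-i}V)$. Theorem. (1) $V=\bigoplus_{i=0}^dU_i=\bigoplus_{i=0}^dU_i^{\Downarrow}$, so that the projections $F_i$ of $V$ onto $U_i$ and $F_i^{\Downarrow}$ of $V$ onto $U_i^{\Downarrow}$ along the other summands,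 and the map $\Delta=\sum_{h=0}^dF_h^{\Downarrow}F_h$, are defined. There is exactly one linear map $\Psi:V\to V$ such that $\Psi\tau_{ij}(A)v=(\vartheta_j-\vartheta_i)\,\tau_{i,j-1}(A)v$ for all $0\le i\le d/2$, $i\le j\le d-i$ and $v\in K_i$ (the right-hand side being $0$ for $j=i$). (2) Let $\beta\in\mathbb K$ satisfy $\beta+1=\frac{\theta_0-\theta_3}{\theta_1-\theta_2}$ if $d\ge3$, and let $\beta$ be any nonzero scalar if $d\le2$. Suppose that $\beta\ne\pm2$; or that $\beta=2$ and $\operatorname{char}\mathbb K\ne2$; or that $\beta=-2$, $\operatorname{char}\mathbb K\ne2$ and $d$ is even. Then $\vartheta_1,\dots,\vartheta_d$ are all nonzero. (3) Suppose that $\vartheta_1,\dots,\vartheta_d$ are all nonzero. Then $\Delta$ is invertible and $$\Delta=\sum_{k=0}^d\frac{\eta_k(\theta_0)}{\vartheta_1\cdots\vartheta_k}\Psi^k,\qquad \Delta^{-1}=\sum_{k=0}^d\frac{\tau_k(\theta_d)}{\vartheta_1\cdots\vartheta_k}\Psi^k .$$ In particular each of $\Delta$, $\Delta^{-1}$ is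 $p(\Psi)$ for some polynomial $p\in\mathbb K[x]$ of degree exactly $d$. -/

import Mathlib

open Polynomial

section TridiagonalPairs

variable {K V : Type*} [Field K] [AddCommGroup V] [Module K V]

/-- `W` is an eigenspace of `A`: it is nonzero and of the form `{v | A v = θ v}`. -/
def IsEigenspace (A : Module.End K V) (W : Submodule K V) : Prop :=
  W ≠ ⊥ ∧ ∃ θ : K, W = A.eigenspace θ

/-- `A` is diagonalizable: `V` is spanned by the eigenspaces of `A`. -/
def IsDiagonalizable (A : Module.End K V) : Prop :=
  ⨆ θ : K, A.eigenspace θ = ⊤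

/-- `W 0, …, W d` is an ordering of the eigenspaces of `A`: every eigenspace of `A` is listed
exactly once, and nothing else is listed. -/
def IsEigenspaceOrdering (A : Module.End K V) {d : ℕ} (W : Fin (d + 1) → Submodule K V) : Prop :=
  Function.Injective W ∧ Set.range W = {S | IsEigenspace A S}

/-- `W 0, …, W d` is an ordering of the eigenspaces of `A` such that
`B (W i) ⊆ W (i-1) + W i + W (i+1)` for all `i`, where `W (-1) = 0` and `W (d+1) = 0`. -/
def IsStandardOrdering (A B : Module.End K V) {d : ℕ} (W : Fin (d + 1) → Submodule K V) : Prop :=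
  IsEigenspaceOrdering A W ∧
    ∀ i : Fin (d + 1), (W i).map B ≤
      ⨆ (j : Fin (d + 1)) (_ : (j : ℕ) ≤ (i : ℕ) + 1 ∧ (i : ℕ) ≤ (j : ℕ) + 1), W j

/-- `A, B` is a tridiagonal pair on `V` (the second map is usually written `A*`). -/
structure IsTridiagonalPair (A B : Module.End K V) : Prop where
  diagonalizable_left : IsDiagonalizable A
  diagonalizable_right : IsDiagonalizable B
  ordering_left : ∃ (d : ℕ) (W : Fin (d + 1) → Submodule K V), IsStandardOrdering A B W
  ordering_right : ∃ (δ : ℕ) (W : Fin (δ + 1) → Submodule K V), IsStandardOrdering B A W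
  irreducible : ¬ ∃ W : Submodule K V, W.map A ≤ W ∧ W.map B ≤ W ∧ W ≠ ⊥ ∧ W ≠ ⊤

/-- `E 0, …, E d` is a standard ordering of the primitive idempotents of `A`, relative to `B`:
the images `E i V` form a standard ordering of the eigenspaces of `A`, and `E i` is the identity
on `E i V` and zero on `E j V` for `j ≠ i`. -/
def IsStandardIdempotents (A B : Module.End K V) {d : ℕ} (E : Fin (d + 1) → Module.End K V) :
    Prop :=
  IsStandardOrdering A B (fun i => LinearMap.range (E i)) ∧
    ∀ i j : Fin (d + 1), ∀ v ∈ LinearMap.range (E j), E i v = if i = j then v else 0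

variable (K V) in
/-- A tridiagonal system `(A; {E i}; A*; {E* i})` on `V` of diameter `d`. -/
structure TDSystem (d : ℕ) where
  A : Module.End K V
  E : Fin (d + 1) → Module.End K V
  Astar : Module.End K V
  Estar : Fin (d + 1) → Module.End K V
  pair : IsTridiagonalPair A Astar
  idempotents : IsStandardIdempotents A Astar E
  idempotents_star : IsStandardIdempotents Astar A Estar

/-- The projection of `V` onto `U i` along the sum of the `U j`, `j ≠ i`
(and zero if these two subspaces are not complementary). -/
noncomputable def componentProjection {d : ℕ} (U : Fin (d + 1) → Submodule K V)
    (i : Fin (d + 1)) : Module.End K V :=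
  open Classical in
  if h : IsCompl (U i) (⨆ (j : Fin (d + 1)) (_ : j ≠ i), U j) then (U i).projection _ h else 0

namespace TDSystem

variable {d : ℕ} (Φ : TDSystem K V d)

theorem exists_eigenvalue (i : Fin (d + 1)) :
    ∃ θ : K, LinearMap.range (Φ.E i) = Φ.A.eigenspace θ := by
  have h : LinearMap.range (Φ.E i) ∈ {S | IsEigenspace Φ.A S} := by
    rw [← Φ.idempotents.1.1.2]
    exact ⟨i, rfl⟩
  exact h.2

/-- The eigenvalue `θ i` of `A` associated with `E i`. -/
noncomputable def θ (i : Fin (d + 1)) : K := (Φ.exists_eigenvalue i).choose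

theorem range_E (i : Fin (d + 1)) : LinearMap.range (Φ.E i) = Φ.A.eigenspace (Φ.θ i) :=
  (Φ.exists_eigenvalue i).choose_spec

/-- `τ i j = (x - θ_i)(x - θ_{i+1}) ⋯ (x - θ_{j-1})`, for `0 ≤ i ≤ j ≤ d + 1`. -/
noncomputable def τ (i j : ℕ) : K[X] :=
  ∏ h ∈ Finset.univ.filter (fun h : Fin (d + 1) => i ≤ (h : ℕ) ∧ (h : ℕ) < j), (X - C (Φ.θ h))

/-- `η i j = (x - θ_{d-i})(x - θ_{d-i-1}) ⋯ (x - θ_{d-j+1})`, for `0 ≤ i ≤ j ≤ d + 1`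
(here `h.rev` is `d - h`). -/
noncomputable def η (i j : ℕ) : K[X] :=
  ∏ h ∈ Finset.univ.filter (fun h : Fin (d + 1) => i ≤ (h : ℕ) ∧ (h : ℕ) < j), (X - C (Φ.θ h.rev))

/-- `ϑ i = ∑_{h=0}^{i-1} (θ_h - θ_{d-h}) / (θ_0 - θ_d)`, for `0 ≤ i ≤ d + 1`. -/
noncomputable def vartheta (i : ℕ) : K :=
  ∑ h ∈ Finset.univ.filter (fun h : Fin (d + 1) => (h : ℕ) < i),
    (Φ.θ h - Φ.θ h.rev) / (Φ.θ 0 - Φ.θ (Fin.last d))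

/-- First split decomposition: `U i = (E*_0 V + ⋯ + E*_i V) ∩ (E_i V + ⋯ + E_d V)`. -/
def U (i : Fin (d + 1)) : Submodule K V :=
  (⨆ (j : Fin (d + 1)) (_ : j ≤ i), LinearMap.range (Φ.Estar j)) ⊓
    (⨆ (j : Fin (d + 1)) (_ : i ≤ j), LinearMap.range (Φ.E j))

/-- Second split decomposition: `U⇓ i = (E*_0 V + ⋯ + E*_i V) ∩ (E_0 V + ⋯ + E_{d-i} V)`. -/
def Udown (i : Fin (d + 1)) : Submodule K V :=
  (⨆ (j : Fin (d + 1)) (_ : j ≤ i), LinearMap.range (Φ.Estar j)) ⊓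
    (⨆ (j : Fin (d + 1)) (_ : j ≤ i.rev), LinearMap.range (Φ.E j))

/-- `F i`, the projection of `V` onto `U i`. -/
noncomputable def F (i : Fin (d + 1)) : Module.End K V := componentProjection Φ.U i

/-- `F⇓ i`, the projection of `V` onto `U⇓ i`. -/
noncomputable def Fdown (i : Fin (d + 1)) : Module.End K V := componentProjection Φ.Udown i

/-- `Δ = ∑_{h=0}^d F⇓_h F_h`. -/
noncomputable def Δ : Module.End K V := ∑ h : Fin (d + 1), Φ.Fdown h * Φ.F h

/-- `K_i = (E*_0 V + ⋯ + E*_i V) ∩ (E_i V + ⋯ + E_{d-i} V)`, for `0 ≤ i ≤ d / 2`. -/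
def Ksub (i : ℕ) : Submodule K V :=
  (⨆ (j : Fin (d + 1)) (_ : (j : ℕ) ≤ i), LinearMap.range (Φ.Estar j)) ⊓
    (⨆ (j : Fin (d + 1)) (_ : i ≤ (j : ℕ) ∧ (j : ℕ) + i ≤ d), LinearMap.range (Φ.E j))

/-- The defining property of `Ψ`: for `0 ≤ i ≤ d / 2` and `i ≤ j ≤ d - i` the map
`Ψ τ_{ij}(A) - (ϑ_j - ϑ_i) τ_{i,j-1}(A)` vanishes on `K_i`. For `j = i` the coefficient
`ϑ_j - ϑ_i` is zero, so the meaning of `τ_{i,i-1}` does not matter. -/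
def IsPsi (P : Module.End K V) : Prop :=
  ∀ i j : ℕ, i ≤ j → i + j ≤ d → ∀ v ∈ Φ.Ksub i,
    P (aeval Φ.A (Φ.τ i j) v) =
      (Φ.vartheta j - Φ.vartheta i) • aeval Φ.A (Φ.τ i (j - 1)) v

/-- `Ψ`, the linear map with the property `IsPsi` (and zero if there were none). -/
noncomputable def Ψ : Module.End K V :=
  open Classical in
  if h : ∃ P : Module.End K V, Φ.IsPsi P then h.choose else 0

/-- `β` is a base of the system. If `d ≥ 3`, then `β + 1` is the common value of the quotients
`(θ_{i-2} - θ_{i+1}) / (θ_{i-1} - θ_i)`, `2 ≤ i ≤ d - 1`, read off at `i = 2`; that the other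
quotients agree with it is not assumed. If `d ≤ 2`, then `β` is any nonzero scalar. -/
def IsBase (β : K) : Prop :=
  (∀ h : 3 ≤ d, β + 1 =
    (Φ.θ 0 - Φ.θ ⟨3, by omega⟩) / (Φ.θ ⟨1, by omega⟩ - Φ.θ ⟨2, by omega⟩)) ∧
  (d ≤ 2 → β ≠ 0)

end TDSystem

end TridiagonalPairs

/-! Everything rests on one family of vectors: the τ_{ij}(A)v with v ∈ K_i and i ≤ j ≤ d-i. They
span V, and the sum of the spaces τ_{ij}(A)K_i is direct (the refined split decomposition), so
linear maps may be defined and compared on them. Irreducibility gives both V = ⊕U_j and the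
triviality of (E*_0V+⋯+E*_{r-1}V) ∩ (E_rV+⋯+E_dV). Reversing the order of either set of eigenspaces
gives further disjointness statements. These make τ_{ij}(A) injective on E*_0V+⋯+E*_iV for i+j ≤ d,
and carry U_i onto U_{d-i} under τ_{i,d-i}(A); the refinement follows. In particular Ψ exists and is
unique.

On this family Δ replaces τ by η. Indeed τ_{ij}(A)v lies in U_j, while τ_{ij} is η_{ij} plus a
combination of η_{im} with m < j, and η_{im}(A)v ∈ U⇓_m. Hence F⇓_j keeps exactly η_{ij}(A)v
(`sum_projection_apply`).

For fixed v the vectors τ_{ij}(A)v form a ladder that Ψ descends with weights ϑ_j - ϑ_i. The formula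
for Δ is therefore an expansion of η_{ij} in the τ_{im} (`rootProd_reverse_eq_sum`), and comparison
of coefficients reduces it to the scalar identity (θ_a - θ_{d-a-t}) ϑ_{t+1} = (θ_0 -
θ_{d-t})(ϑ_{a+t+1} - ϑ_a). As functions of a, θ_a - θ_{d-a-t} and ϑ_{a+t+1} - ϑ_a are antisymmetric
solutions of one linear recurrence, hence proportional (`sub_mul_reflectedSum`). The inverse comes
from the same argument with the θ_i reversed, which leaves ϑ unchanged.

The recurrence θ_i + θ_{i+2} = βθ_{i+1} + γ comes from a polynomial p with A²A*A - AA*A² = [p(A),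
A*]. Applying this to E*_0V forces deg p ≤ 3 (`natDegree_le_three`), and divided differences of p
give the recurrence. It also factors the ϑ_i, which settles when they are nonzero. -/

/-! ### Sums of eigenspaces as kernels of polynomials, and block tridiagonal actions. -/

section SpectralSums

variable {K V : Type*} [Field K] [AddCommGroup V] [Module K V]

/-- The polynomial `(X - θ a) (X - θ (a+1)) ⋯ (X - θ (b-1))`. -/
noncomputable def rootProd (θ : ℕ → K) (a b : ℕ) : K[X] := ∏ h ∈ Finset.Ico a b, (X - C (θ h))

/-- The sum of the eigenspaces of `A` for `θ a, …, θ (b-1)`, as the kernel of a polynomial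
in `A`. -/
noncomputable def spectralSum (A : Module.End K V) (θ : ℕ → K) (a b : ℕ) : Submodule K V :=
  LinearMap.ker (aeval A (rootProd θ a b))

theorem mem_spectralSum {A : Module.End K V} {θ : ℕ → K} {a b : ℕ} {x : V} :
    x ∈ spectralSum A θ a b ↔ aeval A (rootProd θ a b) x = 0 := LinearMap.mem_ker

theorem rootProd_self (θ : ℕ → K) (a : ℕ) : rootProd θ a a = 1 := by simp [rootProd]

theorem rootProd_succ (θ : ℕ → K) {a b : ℕ} (h : a ≤ b) :
    rootProd θ a (b + 1) = rootProd θ a b * (X - C (θ b)) := by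
  rw [rootProd, Finset.prod_Ico_succ_top h, rootProd]

theorem rootProd_eq_mul (θ : ℕ → K) {a b : ℕ} (h : a < b) :
    rootProd θ a b = (X - C (θ a)) * rootProd θ (a + 1) b := by
  rw [rootProd, Finset.prod_eq_prod_Ico_succ_bot h, rootProd]

theorem rootProd_mul (θ : ℕ → K) {a b c : ℕ} (h : a ≤ b) (h' : b ≤ c) :
    rootProd θ a b * rootProd θ b c = rootProd θ a c :=
  Finset.prod_Ico_consecutive _ h h'

theorem rootProd_monic (θ : ℕ → K) (a b : ℕ) : (rootProd θ a b).Monic :=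
  monic_prod_of_monic _ _ fun _ _ => monic_X_sub_C _

theorem natDegree_rootProd (θ : ℕ → K) (a b : ℕ) : (rootProd θ a b).natDegree = b - a := by
  simp [rootProd]

theorem eval_rootProd (θ : ℕ → K) {a b h : ℕ} (h₁ : a ≤ h) (h₂ : h < b) :
    (rootProd θ a b).eval (θ h) = 0 := by
  rw [rootProd, eval_prod]
  exact Finset.prod_eq_zero (Finset.mem_Ico.2 ⟨h₁, h₂⟩) (by simp)

theorem rootProd_reflect (θ : ℕ → K) {a b d : ℕ} (h : b ≤ d + 1) :
    rootProd (fun n => θ (d - n)) a b = rootProd θ (d + 1 - b) (d + 1 - a) :=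
  Finset.prod_Ico_reflect (fun n => X - C (θ n)) a h

theorem aeval_X_sub_C_apply (A : Module.End K V) (μ : K) (x : V) :
    aeval A (X - C μ) x = A x - μ • x := by
  simp

theorem aeval_rootProd_succ (A : Module.End K V) (θ : ℕ → K) {a b : ℕ} (h : a ≤ b) (x : V) :
    aeval A (rootProd θ a (b + 1)) x =
      A (aeval A (rootProd θ a b) x) - θ b • aeval A (rootProd θ a b) x := by
  rw [rootProd_succ θ h, mul_comm, map_mul, Module.End.mul_apply, aeval_X_sub_C_apply]

theorem aeval_rootProd_trans (A : Module.End K V) (θ : ℕ → K) {a b c : ℕ} (h : a ≤ b)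
    (h' : b ≤ c) (x : V) :
    aeval A (rootProd θ b c) (aeval A (rootProd θ a b) x) = aeval A (rootProd θ a c) x := by
  rw [← rootProd_mul θ h h', mul_comm, map_mul, Module.End.mul_apply]

theorem spectralSum_self (A : Module.End K V) (θ : ℕ → K) {a b : ℕ} (h : b ≤ a) :
    spectralSum A θ a b = ⊥ := by
  rw [spectralSum, rootProd, Finset.Ico_eq_empty_of_le h, Finset.prod_empty, map_one]
  exact LinearMap.ker_id

theorem spectralSum_mono (A : Module.End K V) (θ : ℕ → K) {a b a' b' : ℕ} (h : a' ≤ a)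
    (h' : b ≤ b') : spectralSum A θ a b ≤ spectralSum A θ a' b' := by
  intro x hx
  rw [mem_spectralSum] at *
  obtain ⟨q, hq⟩ : rootProd θ a b ∣ rootProd θ a' b' :=
    Finset.prod_dvd_prod_of_subset _ _ _ (Finset.Ico_subset_Ico h h')
  rw [hq, mul_comm, map_mul, Module.End.mul_apply, hx, map_zero]

theorem apply_mem_spectralSum {A : Module.End K V} {θ : ℕ → K} {a b : ℕ} {x : V}
    (hx : x ∈ spectralSum A θ a b) : A x ∈ spectralSum A θ a b := by
  rw [mem_spectralSum] at *
  have h : aeval A (rootProd θ a b * X) x = aeval A (X * rootProd θ a b) x := by rw [mul_comm]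
  rw [map_mul, map_mul, aeval_X, Module.End.mul_apply, Module.End.mul_apply, hx, map_zero] at h
  exact h

theorem sub_smul_mem_spectralSum_bot {A : Module.End K V} {θ : ℕ → K} {a b : ℕ} {x : V}
    (hx : x ∈ spectralSum A θ a b) : A x - θ a • x ∈ spectralSum A θ (a + 1) b := by
  rcases lt_or_ge a b with h | h
  · rw [mem_spectralSum] at *
    rw [← aeval_X_sub_C_apply, ← Module.End.mul_apply, ← map_mul, mul_comm, ← rootProd_eq_mul θ h,
      hx]
  · rw [spectralSum_self A θ h, Submodule.mem_bot] at hx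
    simp [hx]

theorem sub_smul_mem_spectralSum_top {A : Module.End K V} {θ : ℕ → K} {a b : ℕ} {x : V}
    (h : a ≤ b) (hx : x ∈ spectralSum A θ a (b + 1)) : A x - θ b • x ∈ spectralSum A θ a b := by
  rw [mem_spectralSum] at *
  rw [← aeval_X_sub_C_apply, ← Module.End.mul_apply, ← map_mul, ← rootProd_succ θ h, hx]

/-- Linear factors with distinct roots are coprime, so the kernel of their product is the sum of
their kernels. -/
theorem ker_aeval_prod_eq_iSup (A : Module.End K V) {ι : Type*} (θ : ι → K) (s : Finset ι)
    (hs : Set.InjOn θ s) :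
    LinearMap.ker (aeval A (∏ h ∈ s, (X - C (θ h)))) = ⨆ h ∈ s, A.eigenspace (θ h) := by
  classical
  induction s using Finset.induction_on with
  | empty =>
      simp only [Finset.prod_empty, map_one, Finset.notMem_empty, iSup_false, iSup_bot]
      exact LinearMap.ker_id
  | insert a s ha ih =>
    have hc : IsCoprime (X - C (θ a)) (∏ h ∈ s, (X - C (θ h))) := by
      refine IsCoprime.prod_right fun h hh => ?_
      refine isCoprime_X_sub_C_of_isUnit_sub (sub_ne_zero.2 fun e => ha ?_).isUnit
      rw [hs (by simp) (by simp [hh]) e]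
      exact hh
    rw [Finset.prod_insert ha, ← sup_ker_aeval_eq_ker_aeval_mul_of_coprime _ hc,
      ih (hs.mono (by simp)), Finset.iSup_insert]
    congr 1
    ext x
    rw [LinearMap.mem_ker, aeval_X_sub_C_apply, Module.End.mem_eigenspace_iff, sub_eq_zero]

theorem spectralSum_eq_iSup (A : Module.End K V) {θ : ℕ → K} {a b d : ℕ}
    (hθ : Set.InjOn θ (Set.Iic d)) (hb : b ≤ d + 1) :
    spectralSum A θ a b = ⨆ h ∈ Finset.Ico a b, A.eigenspace (θ h) :=
  ker_aeval_prod_eq_iSup A θ _ (hθ.mono fun h hh => by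
    have := Finset.mem_Ico.1 (Finset.mem_coe.1 hh)
    simp only [Set.mem_Iic]; omega)

/-- `θ 0, …, θ d` are the distinct eigenvalues of the diagonalizable map `A`, and `B` acts on the
eigenspaces of `A` in a block tridiagonal fashion; the latter is expressed by polynomials in `A`
that vanish on neighbouring eigenvalues. -/
structure IsTridiagonalAction (A B : Module.End K V) (d : ℕ) (θ : ℕ → K) : Prop where
  injOn : Set.InjOn θ (Set.Iic d)
  aeval_eq_zero : aeval A (rootProd θ 0 (d + 1)) = 0
  eigenspace_ne_bot : ∀ i ≤ d, A.eigenspace (θ i) ≠ ⊥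
  tridiagonal : ∀ i ≤ d, ∀ v, A v = θ i • v → ∀ q : K[X],
    (∀ j ≤ d, j ≤ i + 1 → i ≤ j + 1 → q.eval (θ j) = 0) → aeval A q (B v) = 0

namespace IsTridiagonalAction

variable {A B : Module.End K V} {d : ℕ} {θ : ℕ → K} (H : IsTridiagonalAction A B d θ)
include H

/-- Adjacency of indices is preserved by i ↦ d - i, so each later result also holds in mirror image.
-/
theorem reverse : IsTridiagonalAction A B d (fun n => θ (d - n)) where
  injOn i hi j hj h := by
    simp only [Set.mem_Iic] at hi hj
    have := H.injOn (by simp) (by simp) h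
    omega
  aeval_eq_zero := by
    rw [rootProd_reflect θ le_rfl]
    simpa using H.aeval_eq_zero
  eigenspace_ne_bot i hi := H.eigenspace_ne_bot _ (by omega)
  tridiagonal i hi v hv q hq := by
    refine H.tridiagonal _ (by omega) v hv q fun j hj h₁ h₂ => ?_
    have := hq (d - j) (by omega) (by omega) (by omega)
    rwa [Nat.sub_sub_self hj] at this

theorem spectralSum_eq_top {b : ℕ} (hb : d + 1 ≤ b) : spectralSum A θ 0 b = ⊤ := by
  refine top_le_iff.1 (le_trans ?_ (spectralSum_mono A θ le_rfl hb))
  intro x _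
  rw [mem_spectralSum, H.aeval_eq_zero, LinearMap.zero_apply]

theorem apply_mem_spectralSum_up {n : ℕ} {x : V} (hx : x ∈ spectralSum A θ 0 n) :
    B x ∈ spectralSum A θ 0 (n + 1) := by
  rcases le_or_gt n d with hn | hn
  · suffices h : spectralSum A θ 0 n ≤ (spectralSum A θ 0 (n + 1)).comap B from h hx
    rw [spectralSum_eq_iSup A H.injOn (by omega)]
    refine iSup₂_le fun i hi v hv => ?_
    rw [Finset.mem_Ico] at hi
    rw [Module.End.mem_eigenspace_iff] at hv
    exact mem_spectralSum.2 (H.tridiagonal i (by omega) v hv _ fun j _ _ _ =>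
      eval_rootProd θ (by omega) (by omega))
  · rw [H.spectralSum_eq_top (by omega)]
    trivial

theorem apply_mem_spectralSum_down {n : ℕ} {x : V} (hx : x ∈ spectralSum A θ n (d + 1)) :
    B x ∈ spectralSum A θ (n - 1) (d + 1) := by
  suffices h : spectralSum A θ n (d + 1) ≤ (spectralSum A θ (n - 1) (d + 1)).comap B from h hx
  rw [spectralSum_eq_iSup A H.injOn le_rfl]
  refine iSup₂_le fun i hi v hv => ?_
  rw [Finset.mem_Ico] at hi
  rw [Module.End.mem_eigenspace_iff] at hv
  exact mem_spectralSum.2 (H.tridiagonal i (by omega) v hv _ fun j _ _ _ =>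
    eval_rootProd θ (by omega) (by omega))

theorem spectralSum_ne_top : spectralSum A θ 0 d ≠ ⊤ := by
  intro h
  obtain ⟨v, hv, hv0⟩ := Submodule.exists_mem_ne_zero_of_ne_bot (H.eigenspace_ne_bot d le_rfl)
  rw [Module.End.mem_eigenspace_iff] at hv
  have hm : v ∈ spectralSum A θ 0 d := h ▸ Submodule.mem_top
  rw [mem_spectralSum, Module.End.aeval_apply_of_mem_apply_eq_smul hv, smul_eq_zero, or_iff_left hv0, rootProd,
    eval_prod, Finset.prod_eq_zero_iff] at hm
  obtain ⟨i, hi, h0⟩ := hm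
  have hi' := (Finset.mem_Ico.1 hi).2
  rw [eval_sub, eval_X, eval_C, sub_eq_zero] at h0
  have := H.injOn (by simp) (by simp only [Set.mem_Iic]; omega) h0
  omega

end IsTridiagonalAction

end SpectralSums

/-! ### The split decomposition and its refinement. -/

section SplitDecomposition

variable {K V : Type*} [Field K] [AddCommGroup V] [Module K V]

/-- The data of a tridiagonal system with eigenvalue sequences `θ` and `θs`. -/
structure IsTridiagonalData (A B : Module.End K V) (d : ℕ) (θ θs : ℕ → K) : Prop where
  left : IsTridiagonalAction A B d θ
  right : IsTridiagonalAction B A d θs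
  irreducible : ∀ W : Submodule K V, (∀ x ∈ W, A x ∈ W) → (∀ x ∈ W, B x ∈ W) → W = ⊥ ∨ W = ⊤

/-- The `i`-th component of the split decomposition. -/
noncomputable def splitComponent (A B : Module.End K V) (d : ℕ) (θ θs : ℕ → K) (i : ℕ) :
    Submodule K V :=
  spectralSum B θs 0 (i + 1) ⊓ spectralSum A θ i (d + 1)

/-- The subspace of the `i`-th component of the split decomposition that generates the refined
split decomposition. -/
noncomputable def splitKernel (A B : Module.End K V) (d : ℕ) (θ θs : ℕ → K) (i : ℕ) :
    Submodule K V :=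
  spectralSum B θs 0 (i + 1) ⊓ spectralSum A θ i (d + 1 - i)

theorem splitComponent_eq_bot (A B : Module.End K V) {d : ℕ} (θ θs : ℕ → K) {i : ℕ} (hi : d < i) : splitComponent A B d θ θs i = ⊥ := by
  rw [splitComponent, spectralSum_self A θ hi, inf_bot_eq]

theorem splitKernel_le_splitComponent (A B : Module.End K V) {d : ℕ} (θ θs : ℕ → K) (i : ℕ) :
    splitKernel A B d θ θs i ≤ splitComponent A B d θ θs i :=
  inf_le_inf_left _ (spectralSum_mono A θ le_rfl (by omega))

namespace IsTridiagonalData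

variable {A B : Module.End K V} {d : ℕ} {θ θs : ℕ → K} (D : IsTridiagonalData A B d θ θs)

include D

theorem swap : IsTridiagonalData B A d θs θ where
  left := D.right
  right := D.left
  irreducible W h₁ h₂ := D.irreducible W h₂ h₁

theorem reverse : IsTridiagonalData A B d (fun n => θ (d - n)) θs where
  left := D.left.reverse
  right := D.right
  irreducible := D.irreducible

theorem raise_mem {m r : ℕ} {x : V}
    (hx : x ∈ spectralSum B θs 0 m ⊓ spectralSum A θ r (d + 1)) :
    A x - θ r • x ∈ spectralSum B θs 0 (m + 1) ⊓ spectralSum A θ (r + 1) (d + 1) :=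
  ⟨Submodule.sub_mem _ (D.right.apply_mem_spectralSum_up hx.1)
    (Submodule.smul_mem _ _ (spectralSum_mono B θs le_rfl (Nat.le_succ m) hx.1)),
    sub_smul_mem_spectralSum_bot hx.2⟩

theorem lower_mem {m r : ℕ} {x : V}
    (hx : x ∈ spectralSum B θs 0 (m + 1) ⊓ spectralSum A θ r (d + 1)) :
    B x - θs m • x ∈ spectralSum B θs 0 m ⊓ spectralSum A θ (r - 1) (d + 1) :=
  ⟨sub_smul_mem_spectralSum_top (Nat.zero_le m) hx.1,
    Submodule.sub_mem _ (D.left.apply_mem_spectralSum_down hx.2)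
      (Submodule.smul_mem _ _ (spectralSum_mono A θ (Nat.sub_le r 1) le_rfl hx.2))⟩

/-- The sum is invariant under both maps: `A - θ r` sends the `r`-th term into the next one, and `B
- θs (r + e - 1)` sends it into the previous one. Irreducibility then leaves two cases. The offset
`e = 0` gives disjointness, and `e = 1` gives spanning. -/
theorem iSup_inf_eq_bot_or_top (e : ℕ) :
    (⨆ r : ℕ, spectralSum B θs 0 (r + e) ⊓ spectralSum A θ r (d + 1)) = ⊥ ∨
      (⨆ r : ℕ, spectralSum B θs 0 (r + e) ⊓ spectralSum A θ r (d + 1)) = ⊤ := by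
  have hle := le_iSup (fun r : ℕ => spectralSum B θs 0 (r + e) ⊓ spectralSum A θ r (d + 1))
  refine D.irreducible _ (fun x hx => ?_) (fun x hx => ?_)
  · refine Submodule.iSup_induction _ (motive := fun x => A x ∈ _) hx (fun r y hy => ?_) ?_ ?_
    · rw [← sub_add_cancel (A y) (θ r • y)]
      refine Submodule.add_mem _ (hle (r + 1) ?_) (Submodule.smul_mem _ _ (hle r hy))
      have := D.raise_mem hy
      rwa [add_right_comm] at this
    · simp
    · intro y z hy hz
      rw [map_add]
      exact Submodule.add_mem _ hy hz
  · refine Submodule.iSup_induction _ (motive := fun x => B x ∈ _) hx (fun r y hy => ?_) ?_ ?_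
    · rcases Nat.eq_zero_or_pos (r + e) with h0 | h0
      · have : y = 0 := by
          have := hy.1
          rwa [h0, spectralSum_self B θs le_rfl, SetLike.mem_coe, Submodule.mem_bot] at this
        simp [this]
      · obtain ⟨m, hm⟩ : ∃ m, r + e = m + 1 := ⟨r + e - 1, by omega⟩
        rw [← sub_add_cancel (B y) (θs m • y)]
        refine Submodule.add_mem _ (hle (r - 1) ?_) (Submodule.smul_mem _ _ (hle r hy))
        simp only [hm] at hy
        have := D.lower_mem hy
        exact ⟨spectralSum_mono B θs le_rfl (by omega) this.1, this.2⟩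
    · simp
    · intro y z hy hz
      rw [map_add]
      exact Submodule.add_mem _ hy hz

theorem spectralSum_inf_eq_bot (r : ℕ) :
    spectralSum B θs 0 r ⊓ spectralSum A θ r (d + 1) = ⊥ := by
  rcases D.iSup_inf_eq_bot_or_top 0 with h | h
  · rw [iSup_eq_bot] at h
    exact h r
  -- With offset 0 every term lies in the sum of the first `d` eigenspaces of `B`, a proper
  -- subspace.
  · refine absurd (top_le_iff.1 (h ▸ iSup_le fun r => ?_)) D.right.spectralSum_ne_top
    rcases le_or_gt r d with hr | hr
    · exact inf_le_left.trans (spectralSum_mono B θs le_rfl hr)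
    · rw [spectralSum_self A θ hr, inf_bot_eq]
      exact bot_le

theorem iSup_splitComponent : ⨆ r : ℕ, splitComponent A B d θ θs r = ⊤ := by
  refine (D.iSup_inf_eq_bot_or_top 1).resolve_left fun h => ?_
  rw [iSup_eq_bot] at h
  -- With offset 1 the term at `r = 0` contains the eigenspace of `B` for `θs 0`.
  refine D.right.eigenspace_ne_bot 0 (Nat.zero_le d) (eq_bot_iff.2 ?_)
  rw [← h 0, D.left.spectralSum_eq_top le_rfl, inf_top_eq]
  intro x hx
  rw [Module.End.mem_eigenspace_iff] at hx
  rw [mem_spectralSum, aeval_rootProd_succ _ _ le_rfl, rootProd_self, map_one, Module.End.one_apply,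
    hx, sub_self]

theorem eq_zero_of_mem_of_mem {r : ℕ} {x : V} (h₁ : x ∈ spectralSum B θs 0 r)
    (h₂ : x ∈ spectralSum A θ r (d + 1)) : x = 0 := by
  rw [← Submodule.mem_bot K, ← D.spectralSum_inf_eq_bot r]
  exact ⟨h₁, h₂⟩

/-- This is the disjointness statement for the reversed eigenvalues of `A`; the next lemma reverses
those of `B` instead. -/
theorem eq_zero_of_mem_bottom {a b : ℕ} (hab : a + b ≤ d + 1) {x : V}
    (h₁ : x ∈ spectralSum B θs 0 a) (h₂ : x ∈ spectralSum A θ 0 b) : x = 0 := by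
  refine D.reverse.eq_zero_of_mem_of_mem h₁ ?_
  rw [mem_spectralSum, rootProd_reflect θ le_rfl, ← mem_spectralSum]
  exact spectralSum_mono A θ (by omega) (by omega) h₂

theorem eq_zero_of_mem_top {a b : ℕ} (hab : d + 1 ≤ a + b) {x : V}
    (h₁ : x ∈ spectralSum B θs a (d + 1)) (h₂ : x ∈ spectralSum A θ b (d + 1)) : x = 0 := by
  refine D.swap.reverse.swap.eq_zero_of_mem_of_mem (r := b) ?_ h₂
  rcases le_or_gt b (d + 1) with hb | hb
  · rw [mem_spectralSum, rootProd_reflect θs hb, ← mem_spectralSum]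
    exact spectralSum_mono B θs (by omega) (by omega) h₁
  · rw [spectralSum_self A θ hb.le, Submodule.mem_bot] at h₂
    rw [h₂]
    exact Submodule.zero_mem _

/-! ### Raising and lowering between components. -/

theorem aeval_mem_splitComponent {i j : ℕ} (hij : i ≤ j) {x : V}
    (hx : x ∈ splitComponent A B d θ θs i) :
    aeval A (rootProd θ i j) x ∈ splitComponent A B d θ θs j := by
  induction j, hij using Nat.le_induction with
  | base => simpa [rootProd_self] using hx
  | succ j hij ih =>
    rw [aeval_rootProd_succ A θ hij]
    exact D.raise_mem ih

theorem aeval_right_mem_splitComponent {i j : ℕ} (hij : i ≤ j) {x : V}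
    (hx : x ∈ splitComponent A B d θ θs j) :
    aeval B (rootProd θs (i + 1) (j + 1)) x ∈ splitComponent A B d θ θs i := by
  induction j, hij using Nat.le_induction generalizing x with
  | base => simpa [rootProd_self] using hx
  | succ j hij ih =>
    rw [rootProd_succ θs (by omega), map_mul, Module.End.mul_apply, aeval_X_sub_C_apply]
    have hx' := D.lower_mem (m := j + 1) (r := j + 1) hx
    exact ih hx'

theorem eq_zero_of_aeval_eq_zero {i j : ℕ} (hij : i + j ≤ d) {x : V}
    (hx : x ∈ spectralSum B θs 0 (i + 1)) (h : aeval A (rootProd θ i j) x = 0) : x = 0 :=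
  D.eq_zero_of_mem_bottom (a := i + 1) (b := j) (by omega) hx
    (spectralSum_mono A θ (Nat.zero_le i) le_rfl (mem_spectralSum.2 h))

/-- Lowering U_{d-i} to U_i by a polynomial in `B` and raising back by a polynomial in `A` are both
injective, by disjointness. The composite is an injective endomorphism of a finite-dimensional
space, hence surjective. -/
theorem exists_aeval_eq [FiniteDimensional K V] {i : ℕ} (hi : i + i ≤ d) {y : V}
    (hy : y ∈ splitComponent A B d θ θs (d - i)) :
    ∃ x ∈ splitComponent A B d θ θs i, aeval A (rootProd θ i (d - i)) x = y := by
  have hl := fun z (hz : z ∈ splitComponent A B d θ θs (d - i)) =>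
    D.aeval_right_mem_splitComponent (show i ≤ d - i by omega) hz
  let f : Module.End K (splitComponent A B d θ θs (d - i)) :=
    (aeval A (rootProd θ i (d - i)) * aeval B (rootProd θs (i + 1) (d - i + 1))).restrict
      fun z hz => D.aeval_mem_splitComponent (by omega) (hl z hz)
  have hf : Function.Injective f := by
    rw [injective_iff_map_eq_zero]
    intro z hz
    have hz' : aeval A (rootProd θ i (d - i))
      (aeval B (rootProd θs (i + 1) (d - i + 1)) z) = 0 := congrArg Subtype.val hz
    have h0 := D.eq_zero_of_aeval_eq_zero (by omega) (hl z z.2).1 hz'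
    refine Subtype.ext (D.eq_zero_of_mem_top (a := i + 1) (b := d - i) (by omega) ?_ z.2.2)
    exact spectralSum_mono B θs le_rfl (by omega) (mem_spectralSum.2 h0)
  obtain ⟨z, hz⟩ := (LinearMap.injective_iff_surjective.1 hf) ⟨y, hy⟩
  exact ⟨_, hl z z.2, congrArg Subtype.val hz⟩

theorem aeval_mem_of_mem_splitKernel {i j : ℕ} (hij : i ≤ j) {v : V}
    (hv : v ∈ splitKernel A B d θ θs i) :
    aeval A (rootProd θ i j) v ∈ splitComponent A B d θ θs j :=
  D.aeval_mem_splitComponent hij (splitKernel_le_splitComponent A B θ θs i hv)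

/-- Independence of the components of the split decomposition. -/
theorem eq_zero_of_sum_eq_zero {u : ℕ → V} (n : ℕ)
    (hu : ∀ i < n, u i ∈ splitComponent A B d θ θs i)
    (h : ∑ i ∈ Finset.range n, u i = 0) : ∀ i < n, u i = 0 := by
  induction n with
  | zero => intro i hi; omega
  | succ n ih =>
    rw [Finset.sum_range_succ] at h
    have hn : u n = 0 := by
      refine D.eq_zero_of_mem_of_mem (r := n) ?_ (hu n (Nat.lt_succ_self n)).2
      rw [eq_neg_of_add_eq_zero_right h]
      refine Submodule.neg_mem _ (Submodule.sum_mem _ fun i hi => ?_)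
      rw [Finset.mem_range] at hi
      exact spectralSum_mono B θs le_rfl (by omega) (hu i (by omega)).1
    rw [hn, add_zero] at h
    intro i hi
    rcases Nat.lt_succ_iff_lt_or_eq.1 hi with hi | rfl
    · exact ih (fun i hi => hu i (by omega)) h i hi
    · exact hn

/-- Independence in the refined split decomposition, within one component of the first half. -/
theorem eq_zero_of_sum_aeval_eq_zero {v : ℕ → V} (i : ℕ) (hi : i + i ≤ d)
    (hv : ∀ h ≤ i, v h ∈ splitKernel A B d θ θs h)
    (h0 : ∑ h ∈ Finset.range (i + 1), aeval A (rootProd θ h i) (v h) = 0) :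
    ∀ h ≤ i, v h = 0 := by
  induction i with
  | zero =>
    intro h hh
    obtain rfl : h = 0 := by omega
    simpa [rootProd_self] using h0
  | succ i ih =>
    set w := ∑ h ∈ Finset.range (i + 1), aeval A (rootProd θ h i) (v h) with hw
    have hwU : w ∈ splitComponent A B d θ θs i :=
      Submodule.sum_mem _ fun h hh => by
        rw [Finset.mem_range] at hh
        exact D.aeval_mem_of_mem_splitKernel (by omega) (hv h (by omega))
    have hsum : ∑ h ∈ Finset.range (i + 1), aeval A (rootProd θ h (i + 1)) (v h) =
        A w - θ i • w := by
      rw [hw, map_sum, Finset.smul_sum, ← Finset.sum_sub_distrib]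
      refine Finset.sum_congr rfl fun h hh => ?_
      rw [Finset.mem_range] at hh
      exact aeval_rootProd_succ A θ (by omega) _
    rw [Finset.sum_range_succ, hsum, rootProd_self, map_one, Module.End.one_apply] at h0
    -- The relation now reads (A - θ_i)w + v_{i+1} = 0. Applying τ_{i+1,d-i}(A) kills v_{i+1} and
    -- leaves τ_{i,d-i}(A)w = 0, where τ_{i,d-i}(A) is injective on U_i.
    have hw0 : w = 0 := by
      refine D.eq_zero_of_aeval_eq_zero (i := i) (j := d - i) (by omega) hwU.1 ?_
      rw [rootProd_eq_mul θ (by omega), mul_comm, map_mul, Module.End.mul_apply,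
        aeval_X_sub_C_apply, eq_neg_of_add_eq_zero_left h0, map_neg, neg_eq_zero]
      have := mem_spectralSum.1 (hv (i + 1) le_rfl).2
      convert this using 4
      omega
    rw [hw0, map_zero, smul_zero, sub_zero, zero_add] at h0
    intro h hh
    rcases Nat.le_succ_iff.1 hh with hh | rfl
    · exact ih (by omega) (fun h hh => hv h (by omega)) hw0 h hh
    · exact h0

/-- Spanning in the refined split decomposition, within one component of the first half. -/
theorem splitComponent_le_of_le_half [FiniteDimensional K V] (i : ℕ) (hi : i + i ≤ d) :
    splitComponent A B d θ θs i ≤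
      ⨆ h ∈ Finset.range (i + 1), (splitKernel A B d θ θs h).map (aeval A (rootProd θ h i)) := by
  induction i with
  | zero =>
    refine le_trans (fun x hx => ?_) (le_iSup₂ 0 (Finset.mem_range.2 zero_lt_one))
    exact ⟨x, hx, by simp [rootProd_self]⟩
  | succ i ih =>
    intro u hu
    have hmem := D.aeval_mem_splitComponent (show i + 1 ≤ d - i by omega) hu
    -- With this `w`, the vector u - (A - θ_i)w is killed by τ_{i+1,d-i}(A), so it lies in K_{i+1};
    -- the induction hypothesis handles `w`.
    obtain ⟨w, hw, hwu⟩ := D.exists_aeval_eq (by omega) hmem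
    rw [rootProd_eq_mul θ (by omega), mul_comm, map_mul, Module.End.mul_apply,
        aeval_X_sub_C_apply] at hwu
    rw [← add_sub_cancel (A w - θ i • w) u]
    refine Submodule.add_mem _ ?_ ?_
    · have hmap := Submodule.mem_map_of_mem (f := aeval A (X - C (θ i))) (ih (by omega) hw)
      rw [aeval_X_sub_C_apply] at hmap
      refine (?_ : Submodule.map _ _ ≤ _) hmap
      simp only [Submodule.map_iSup]
      refine iSup₂_le fun h hh => le_trans ?_ (le_iSup₂ h
        (Finset.mem_range.2 (Nat.lt_succ_of_lt (Finset.mem_range.1 hh))))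
      rw [← Submodule.map_comp, ← Module.End.mul_eq_comp, ← map_mul, mul_comm, ← rootProd_succ θ
        (by have := Finset.mem_range.1 hh; omega)]
    · refine Submodule.mem_iSup_of_mem (i + 1) (Submodule.mem_iSup_of_mem (by simp) ?_)
      refine ⟨_, ⟨Submodule.sub_mem _ hu.1 (D.raise_mem hw).1, ?_⟩, by
        rw [rootProd_self, map_one, Module.End.one_apply]⟩
      rw [SetLike.mem_coe, mem_spectralSum, map_sub, sub_eq_zero]
      convert hwu.symm using 4 <;> omega

/-- Beyond the middle, U_j is the image of U_{d-j} under τ_{d-j,j}(A), so the first half determines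
it. -/
theorem splitComponent_le [FiniteDimensional K V] (j : ℕ) :
    splitComponent A B d θ θs j ≤
      ⨆ h ∈ (Finset.range (j + 1)).filter (fun h => h + j ≤ d),
        (splitKernel A B d θ θs h).map (aeval A (rootProd θ h j)) := by
  rcases le_or_gt (j + j) d with hj | hj
  · refine (D.splitComponent_le_of_le_half j hj).trans (iSup₂_le fun h hh => ?_)
    refine le_iSup₂_of_le h ?_ le_rfl
    rw [Finset.mem_range] at hh
    simp only [Finset.mem_filter, Finset.mem_range]
    omega
  rcases le_or_gt j d with hjd | hjd
  · intro u hu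
    obtain ⟨i, rfl⟩ : ∃ i, j = d - i := ⟨d - j, by omega⟩
    have hij : (d - (d - i)) ≤ d - i := by omega
    obtain ⟨x, hx, rfl⟩ := D.exists_aeval_eq (i := d - (d - i)) (by omega) (y := u)
      (by convert hu using 2; omega)
    rw [show d - (d - (d - i)) = d - i by omega]
    obtain ⟨l, hl⟩ : ∃ l, l = d - (d - i) := ⟨_, rfl⟩
    rw [← hl] at hx hij ⊢
    have hmap := Submodule.mem_map_of_mem (f := aeval A (rootProd θ l (d - i)))
      (D.splitComponent_le_of_le_half l (by omega) hx)
    refine (?_ : Submodule.map _ _ ≤ _) hmap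
    simp only [Submodule.map_iSup]
    refine iSup₂_le fun h hh => ?_
    rw [Finset.mem_range] at hh
    refine le_iSup₂_of_le h ?_ ?_
    · simp only [Finset.mem_filter, Finset.mem_range]
      omega
    · rw [← Submodule.map_comp, ← Module.End.mul_eq_comp, ← map_mul, mul_comm,
        rootProd_mul θ (by omega) hij]
  · rw [splitComponent_eq_bot A B θ θs hjd]
    exact bot_le

/-- The refined split decomposition spans `V`. -/
theorem eq_top_of_forall_aeval_mem [FiniteDimensional K V] (S : Submodule K V)
    (hS : ∀ i j : ℕ, i ≤ j → i + j ≤ d → ∀ v ∈ splitKernel A B d θ θs i,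
      aeval A (rootProd θ i j) v ∈ S) : S = ⊤ := by
  rw [← top_le_iff, ← D.iSup_splitComponent]
  refine iSup_le fun j => (D.splitComponent_le j).trans (iSup₂_le fun i hi => ?_)
  simp only [Finset.mem_filter, Finset.mem_range] at hi
  rintro _ ⟨v, hv, rfl⟩
  exact hS i j (by omega) hi.2 v hv

/-- The refined split decomposition is independent. -/
theorem eq_zero_of_sum_sum_aeval_eq_zero {v : ℕ → ℕ → V}
    (hv : ∀ i j, v i j ∈ splitKernel A B d θ θs i)
    (hv0 : ∀ i j, ¬ (i ≤ j ∧ i + j ≤ d) → v i j = 0)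
    (h0 : ∑ j ∈ Finset.range (d + 1), ∑ i ∈ Finset.range (d + 1),
      aeval A (rootProd θ i j) (v i j) = 0) (i j : ℕ) : v i j = 0 := by
  have hmem : ∀ m j i, m ≤ j → aeval A (rootProd θ i m) (v i j) ∈ splitComponent A B d θ θs m ∨
      m < i := by
    intro m j i _
    rcases lt_or_ge m i with h | h
    · exact Or.inr h
    · exact Or.inl (D.aeval_mem_of_mem_splitKernel h (hv i j))
  by_cases hij : i ≤ j ∧ i + j ≤ d
  swap
  · exact hv0 i j hij
  have hrow := D.eq_zero_of_sum_eq_zero (d + 1) (fun j hj => Submodule.sum_mem _ fun i _ => by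
    rcases hmem j j i le_rfl with h | h
    · exact h
    · rw [hv0 i j (by omega), map_zero]
      exact Submodule.zero_mem _) h0 j (by omega)
  -- Only the terms with i ≤ m survive in row `j`. Each has the factor τ_{mj}(A), which is injective
  -- on U_m because m + j ≤ d, so the row can be pulled back to the first half.
  set m := min j (d - j) with hm
  have hm₁ : m ≤ j := by omega
  have hm₂ : m + j ≤ d := by omega
  have hrow' : ∑ h ∈ Finset.range (m + 1), aeval A (rootProd θ h j) (v h j) = 0 := by
    rw [← hrow]
    refine Finset.sum_subset (Finset.range_mono (by omega)) fun h _ hh => ?_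
    rw [Finset.mem_range] at hh
    rw [hv0 h j (by omega), map_zero]
  refine D.eq_zero_of_sum_aeval_eq_zero (v := fun h => v h j) m (by omega) (fun h _ => hv h j) ?_
    i (by omega)
  refine D.eq_zero_of_aeval_eq_zero (i := m) (j := j) (by omega)
    (Submodule.sum_mem _ fun h hh => ?_) ?_
  · rw [Finset.mem_range] at hh
    exact ((hmem m j h hm₁).resolve_right (by omega)).1
  · rw [map_sum, ← hrow']
    refine Finset.sum_congr rfl fun h hh => ?_
    rw [Finset.mem_range] at hh
    exact aeval_rootProd_trans A θ (by omega) hm₁ _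

/-- A linear map can be prescribed on the refined split decomposition. -/
theorem exists_linearMap [FiniteDimensional K V] (T : ℕ → ℕ → Module.End K V) :
    ∃ P : Module.End K V, ∀ i j : ℕ, i ≤ j → i + j ≤ d → ∀ v ∈ splitKernel A B d θ θs i,
      P (aeval A (rootProd θ i j) v) = T i j v := by
  classical
  let M : Submodule K (ℕ → ℕ → V) :=
    { carrier := {v | (∀ i j, v i j ∈ splitKernel A B d θ θs i) ∧
        ∀ i j, ¬ (i ≤ j ∧ i + j ≤ d) → v i j = 0}
      add_mem' := fun ha hb => ⟨fun i j => Submodule.add_mem _ (ha.1 i j) (hb.1 i j),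
        fun i j h => by simp [ha.2 i j h, hb.2 i j h]⟩
      zero_mem' := ⟨fun i j => Submodule.zero_mem _, fun i j _ => rfl⟩
      smul_mem' := fun c v hv => ⟨fun i j => Submodule.smul_mem _ _ (hv.1 i j),
        fun i j h => by simp [hv.2 i j h]⟩ }
  let L : (ℕ → ℕ → Module.End K V) → (M →ₗ[K] V) := fun T =>
    ∑ j ∈ Finset.range (d + 1), ∑ i ∈ Finset.range (d + 1),
      (T i j) ∘ₗ LinearMap.proj j ∘ₗ LinearMap.proj i ∘ₗ M.subtype
  have hL : ∀ T (v : M), L T v =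
      ∑ j ∈ Finset.range (d + 1), ∑ i ∈ Finset.range (d + 1), T i j (v.1 i j) := by
    intro T v
    simp [L, LinearMap.sum_apply]
  have hsingle : ∀ i j : ℕ, i ≤ j → i + j ≤ d → ∀ v ∈ splitKernel A B d θ θs i,
      ∃ f : M, ∀ T, L T f = T i j v := by
    intro i j hij hd v hv
    refine ⟨⟨fun a b => if a = i ∧ b = j then v else 0, fun a b => ?_, fun a b h => ?_⟩, ?_⟩
    · dsimp only
      split_ifs with h
      · rw [h.1]; exact hv
      · exact Submodule.zero_mem _
    · exact if_neg fun h' => h (by rw [h'.1, h'.2]; exact ⟨hij, hd⟩)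
    · intro T
      rw [hL, Finset.sum_eq_single j, Finset.sum_eq_single i]
      · simp
      · intro a _ ha
        simp [ha]
      · intro h
        exact absurd (Finset.mem_range.2 (by omega)) h
      · intro b _ hb
        exact Finset.sum_eq_zero fun a _ => by simp [hb]
      · intro h
        exact absurd (Finset.mem_range.2 (by omega)) h
  -- Independence and spanning of the refined decomposition say that `φ` is bijective; the required
  -- map is `L T` after the inverse of `φ`.
  let φ := L fun i j => aeval A (rootProd θ i j)
  have hinj : Function.Injective φ := by
    rw [injective_iff_map_eq_zero]
    intro f hf
    refine Subtype.ext (funext fun i => funext fun j => ?_)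
    exact D.eq_zero_of_sum_sum_aeval_eq_zero f.2.1 f.2.2 ((hL _ f).symm.trans hf) i j
  have hsurj : Function.Surjective φ := by
    rw [← LinearMap.range_eq_top]
    refine D.eq_top_of_forall_aeval_mem _ fun i j hij hd v hv => ?_
    obtain ⟨f, hf⟩ := hsingle i j hij hd v hv
    exact ⟨f, hf _⟩
  refine ⟨L T ∘ₗ (LinearEquiv.ofBijective φ ⟨hinj, hsurj⟩).symm.toLinearMap,
    fun i j hij hd v hv => ?_⟩
  obtain ⟨f, hf⟩ := hsingle i j hij hd v hv
  rw [← hf (fun i j => aeval A (rootProd θ i j)), ← hf T]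
  exact congrArg _ ((LinearEquiv.ofBijective φ ⟨hinj, hsurj⟩).symm_apply_apply f)

theorem linearMap_ext [FiniteDimensional K V] {P Q : Module.End K V}
    (h : ∀ i j : ℕ, i ≤ j → i + j ≤ d → ∀ v ∈ splitKernel A B d θ θs i,
      P (aeval A (rootProd θ i j) v) = Q (aeval A (rootProd θ i j) v)) : P = Q := by
  rw [← LinearMap.eqLocus_eq_top]
  exact D.eq_top_of_forall_aeval_mem _ h

end IsTridiagonalData

end SplitDecomposition

/-! ### The three-term recurrence for the eigenvalues. -/

section Recurrence

variable {K V : Type*} [Field K] [AddCommGroup V] [Module K V]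

theorem IsTridiagonalAction.aeval_mem_spectralSum_add {A B : Module.End K V} {d : ℕ} {θ : ℕ → K}
    (H : IsTridiagonalAction A B d θ) {m n : ℕ} {v : V} (hv : v ∈ spectralSum A θ 0 m) {q : K[X]}
    (hq : q.natDegree ≤ n) : aeval B q v ∈ spectralSum A θ 0 (m + n) := by
  have hpow : ∀ k : ℕ, (B ^ k) v ∈ spectralSum A θ 0 (m + k) := by
    intro k
    induction k with
    | zero => simpa using hv
    | succ k ih =>
      rw [pow_succ', Module.End.mul_apply, ← add_assoc]
      exact H.apply_mem_spectralSum_up ih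
  rw [aeval_eq_sum_range, LinearMap.sum_apply]
  refine Submodule.sum_mem _ fun k hk => ?_
  rw [Finset.mem_range] at hk
  exact Submodule.smul_mem _ _ (spectralSum_mono A θ le_rfl (by omega) (hpow k))

/-- A map with block tridiagonal action satisfies `A²BA - ABA² = [p(A), B]`, provided that the
values of `p` on consecutive eigenvalues match. -/
theorem IsTridiagonalAction.commutator_identity {A B : Module.End K V} {d : ℕ} {θ : ℕ → K}
    (H : IsTridiagonalAction A B d θ) {p : K[X]}
    (hp : ∀ i < d, p.eval (θ i) - p.eval (θ (i + 1)) = θ i * θ (i + 1) * (θ i - θ (i + 1)))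
    (v : V) :
    A (A (B (A v))) - A (B (A (A v))) = aeval A p (B v) - B (aeval A p v) := by
  have hv : v ∈ spectralSum A θ 0 (d + 1) := by
    rw [H.spectralSum_eq_top le_rfl]
    trivial
  rw [spectralSum_eq_iSup A H.injOn le_rfl] at hv
  suffices h : (⨆ h ∈ Finset.Ico 0 (d + 1), A.eigenspace (θ h)) ≤
      LinearMap.eqLocus (A * A * B * A - A * B * A * A) (aeval A p * B - B * aeval A p) from h hv
  refine iSup₂_le fun i hi x hx => ?_
  rw [Finset.mem_Ico] at hi
  rw [Module.End.mem_eigenspace_iff] at hx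
  -- On the θ_i-eigenspace the identity says q(A)Bx = 0 for the polynomial `q` below, and `hp` makes
  -- `q` vanish at θ_{i-1}, θ_i and θ_{i+1}.
  have key := H.tridiagonal i (by omega) x hx
    (C (θ i) * X ^ 2 - C (θ i ^ 2) * X - p + C (p.eval (θ i))) fun j hj h₁ h₂ => by
      simp only [eval_add, eval_sub, eval_mul, eval_C, eval_X, eval_pow]
      have hcase : j = i ∨ j = i + 1 ∨ i = j + 1 := by omega
      rcases hcase with rfl | rfl | rfl
      · ring
      · linear_combination hp i (by omega)
      · linear_combination -hp j (by omega)
  simp only [map_add, map_sub, map_mul, aeval_C, aeval_X, LinearMap.add_apply,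
    LinearMap.sub_apply, Module.End.mul_apply, Module.algebraMap_end_apply, pow_two] at key
  simp only [LinearMap.mem_eqLocus, LinearMap.sub_apply, Module.End.mul_apply]
  rw [Module.End.aeval_apply_of_mem_apply_eq_smul hx]
  simp only [hx, map_smul]
  rw [← sub_eq_zero, ← key]
  module

/-- On v ∈ E*_0V the left side of the commutator identity reaches at most E*_3V. If n = deg p ≥ 4,
the E*_n-component of [p(A), B]v is θ*_0 - θ*_n times that of p(A)v, so the latter vanishes.
Removing terms of lower degree, τ_{0n}(A)v lies in both E*_0V+⋯+E*_{n-1}V and E_nV+⋯+E_dV, so it is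
zero and `v = 0`. -/
theorem IsTridiagonalData.natDegree_le_three {A B : Module.End K V} {d : ℕ} {θ θs : ℕ → K}
    (D : IsTridiagonalData A B d θ θs) {p : K[X]} (hpd : p.natDegree ≤ d)
    (hp : ∀ i < d, p.eval (θ i) - p.eval (θ (i + 1)) = θ i * θ (i + 1) * (θ i - θ (i + 1))) :
    p.natDegree ≤ 3 := by
  by_contra! hlt
  obtain ⟨t, ht⟩ : ∃ t, p.natDegree = t + 4 := ⟨p.natDegree - 4, by omega⟩
  obtain ⟨v, hv, hv0⟩ :=
    Submodule.exists_mem_ne_zero_of_ne_bot (D.right.eigenspace_ne_bot 0 (Nat.zero_le d))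
  rw [Module.End.mem_eigenspace_iff] at hv
  have hv1 : v ∈ spectralSum B θs 0 1 := by
    rw [mem_spectralSum, aeval_rootProd_succ _ _ le_rfl, rootProd_self, map_one,
      Module.End.one_apply, hv, sub_self]
  have hmono := fun {a b : ℕ} (h : a ≤ b) => spectralSum_mono B θs (le_refl 0) h
  -- the image of `v` under `p(A)` has no component in the last possible eigenspace
  have hlow : aeval A p v ∈ spectralSum B θs 0 (t + 4) := by
    have h1 : B (aeval A p v) - θs 0 • aeval A p v ∈ spectralSum B θs 0 (t + 4) := by
      have h := D.left.commutator_identity hp v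
      rw [hv, map_smul] at h
      rw [← neg_sub, ← h]
      have up := fun {n : ℕ} {x : V} (hx : x ∈ spectralSum B θs 0 n) =>
        D.right.apply_mem_spectralSum_up hx
      have up' := fun {n : ℕ} {x : V} (hx : x ∈ spectralSum B θs 0 n) =>
        apply_mem_spectralSum hx
      exact Submodule.neg_mem _ (Submodule.sub_mem _
        (hmono (by omega) (up (up (up' (up hv1))))) (hmono (by omega) (up (up' (up (up hv1))))))
    have h2 := D.right.aeval_mem_spectralSum_add hv1 (q := p) le_rfl
    rw [ht, add_comm 1] at h2
    have h3 := sub_smul_mem_spectralSum_top (Nat.zero_le _) h2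
    have h4 := Submodule.sub_mem _ h1 h3
    rw [sub_sub_sub_cancel_left, ← sub_smul] at h4
    have hne : θs (t + 4) - θs 0 ≠ 0 := sub_ne_zero.2 fun h => by
      have := D.right.injOn (by simp only [Set.mem_Iic]; omega) (by simp) h
      omega
    exact (Submodule.smul_mem_iff _ hne).1 h4
  have hp0 : p ≠ 0 := by
    rintro rfl
    simp at ht
  have hlead : p.leadingCoeff ≠ 0 := leadingCoeff_ne_zero.2 hp0
  have hmonic := rootProd_monic θ 0 (t + 4)
  have hdeg : (C p.leadingCoeff * rootProd θ 0 (t + 4)).natDegree = t + 4 := by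
    rw [natDegree_C_mul hlead, natDegree_rootProd, Nat.sub_zero]
  have hsub : (p - C p.leadingCoeff * rootProd θ 0 (t + 4)).natDegree ≤ t + 3 := by
    have hC0 : C p.leadingCoeff * rootProd θ 0 (t + 4) ≠ 0 :=
      mul_ne_zero (C_ne_zero.2 hlead) hmonic.ne_zero
    have := degree_sub_lt_left (p := p) (q := C p.leadingCoeff * rootProd θ 0 (t + 4))
      (by rw [degree_eq_natDegree hp0, degree_eq_natDegree hC0, hdeg, ht]) hp0
      (by rw [leadingCoeff_mul, leadingCoeff_C, hmonic.leadingCoeff, mul_one])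
    rw [degree_eq_natDegree hp0, ht] at this
    exact natDegree_le_iff_coeff_eq_zero.2 ((degree_lt_iff_coeff_zero _ (t + 4)).1 this)
  have h5 := D.right.aeval_mem_spectralSum_add hv1 hsub
  rw [add_comm 1] at h5
  have h6 := Submodule.sub_mem _ hlow h5
  rw [map_sub, LinearMap.sub_apply, sub_sub_cancel, map_mul, aeval_C, Module.End.mul_apply,
    Module.algebraMap_end_apply, Submodule.smul_mem_iff _ hlead] at h6
  have hU : v ∈ splitComponent A B d θ θs 0 :=
    ⟨hv1, by rw [D.left.spectralSum_eq_top le_rfl]; trivial⟩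
  exact hv0 (D.eq_zero_of_aeval_eq_zero (i := 0) (j := t + 4) (by omega) hv1
    (D.eq_zero_of_mem_of_mem h6 (D.aeval_mem_splitComponent (Nat.zero_le _) hU).2))

/-- The eigenvalues of a tridiagonal system satisfy a three-term recurrence. -/
theorem IsTridiagonalData.exists_recurrence {A B : Module.End K V} {d : ℕ} {θ θs : ℕ → K}
    (D : IsTridiagonalData A B d θ θs) :
    ∃ β γ : K, ∀ i, i + 2 ≤ d → θ i + θ (i + 2) = β * θ (i + 1) + γ := by
  rcases lt_or_ge d 3 with hd | hd
  · refine ⟨0, θ 0 + θ 2, fun i hi => ?_⟩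
    obtain rfl : i = 0 := by omega
    ring
  have hne : ∀ i j, i ≤ d → j ≤ d → i ≠ j → θ i - θ j ≠ 0 := fun i j hi hj h =>
    sub_ne_zero.2 fun e => h (D.left.injOn hi hj e)
  -- These values telescope to the differences needed in the commutator identity; `p` interpolates
  -- them at the eigenvalues.
  set r : ℕ → K := fun i => -∑ h ∈ Finset.range i, θ h * θ (h + 1) * (θ h - θ (h + 1)) with hr
  set p := Lagrange.interpolate (Finset.range (d + 1)) θ r with hpdef
  have hinj : Set.InjOn θ (Finset.range (d + 1)) := D.left.injOn.mono fun i hi => by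
    have := Finset.mem_range.1 (Finset.mem_coe.1 hi)
    simp only [Set.mem_Iic]; omega
  have heval : ∀ i ≤ d, p.eval (θ i) = r i := fun i hi =>
    Lagrange.eval_interpolate_at_node r hinj (Finset.mem_range.2 (by omega))
  have hpd : p.natDegree ≤ d := by
    have h := Lagrange.degree_interpolate_lt r hinj
    rw [Finset.card_range] at h
    exact natDegree_le_iff_coeff_eq_zero.2 ((degree_lt_iff_coeff_zero _ (d + 1)).1 h)
  have hp : ∀ i < d, p.eval (θ i) - p.eval (θ (i + 1)) = θ i * θ (i + 1) * (θ i - θ (i + 1)) := by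
    intro i hi
    rw [heval i hi.le, heval (i + 1) hi, hr]
    simp only [Finset.sum_range_succ]
    ring
  have h3 := D.natDegree_le_three hpd hp
  have hev : ∀ x, p.eval x = p.coeff 0 + p.coeff 1 * x + p.coeff 2 * x ^ 2 + p.coeff 3 * x ^ 3 := by
    intro x
    rw [eval_eq_sum_range' (Nat.lt_succ_of_le h3)]
    simp [Finset.sum_range_succ]
  -- First divided difference of the cubic; the second one, `hlin`, is already the recurrence up to
  -- dividing by the leading coefficient.
  have hquad : ∀ i < d, θ i * θ (i + 1) = p.coeff 3 * (θ i ^ 2 + θ i * θ (i + 1) + θ (i + 1) ^ 2)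
      + p.coeff 2 * (θ i + θ (i + 1)) + p.coeff 1 := by
    intro i hi
    have h := hp i hi
    rw [hev, hev] at h
    refine mul_right_cancel₀ (hne i (i + 1) hi.le hi (by omega)) ?_
    linear_combination -h
  have hlin : ∀ i, i + 2 ≤ d →
      θ (i + 1) = p.coeff 3 * (θ i + θ (i + 1) + θ (i + 2)) + p.coeff 2 := by
    intro i hi
    refine mul_right_cancel₀ (hne (i + 2) i hi (by omega) (by omega)) ?_
    linear_combination hquad (i + 1) (by omega) - hquad i (by omega)
  have hc : p.coeff 3 ≠ 0 := by
    intro h0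
    have h1 := hlin 0 (by omega)
    have h2 := hlin 1 (by omega)
    rw [h0] at h1 h2
    exact hne 1 2 (by omega) (by omega) (by omega) (by linear_combination h1 - h2)
  refine ⟨(p.coeff 3)⁻¹ - 1, -p.coeff 2 / p.coeff 3, fun i hi => ?_⟩
  have := hlin i hi
  field_simp
  linear_combination -this

end Recurrence

/-! ### Partial sums of θ_h - θ_{d-h} and the proportionality identity. -/

section RecurrentSequences

variable {K : Type*} [Field K]

/-- The partial sums of `θ h - θ (d - h)`. -/
noncomputable def reflectedSum (θ : ℕ → K) (d i : ℕ) : K :=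
  ∑ h ∈ Finset.range i, (θ h - θ (d - h))

theorem reflectedSum_zero (θ : ℕ → K) (d : ℕ) : reflectedSum θ d 0 = 0 := by simp [reflectedSum]

theorem reflectedSum_succ (θ : ℕ → K) (d i : ℕ) :
    reflectedSum θ d (i + 1) = reflectedSum θ d i + (θ i - θ (d - i)) :=
  Finset.sum_range_succ _ _

/-- The summands change sign under h ↦ d - h, and the full sum is zero. -/
theorem reflectedSum_symm (θ : ℕ → K) {d i j : ℕ} (h : i + j = d + 1) :
    reflectedSum θ d i = reflectedSum θ d j := by
  have key : ∀ i, i ≤ d + 1 → reflectedSum θ d i = reflectedSum θ d (d + 1 - i) := by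
    intro i hi
    induction i with
    | zero =>
      rw [Nat.sub_zero, reflectedSum_zero, reflectedSum, Finset.sum_sub_distrib, eq_comm, sub_eq_zero,
        ← Finset.sum_range_reflect θ (d + 1)]
      simp
    | succ i ih =>
      have h1 := reflectedSum_succ θ d (d - i)
      rw [show d - i + 1 = d + 1 - i by omega, Nat.sub_sub_self (show i ≤ d by omega)] at h1
      rw [reflectedSum_succ, ih (by omega), h1, show d + 1 - (i + 1) = d - i by omega]
      ring
  rw [key i (by omega), show d + 1 - i = j by omega]

/-- Two solutions of a linear recurrence on `{0, …, n}` that are antisymmetric about the midpoint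
are proportional. -/
theorem mul_eq_mul_of_antisymmetric {β : K} {n : ℕ} {f g : ℕ → K}
    (hf : ∀ i, i + 2 ≤ n → f i + f (i + 2) = β * f (i + 1))
    (hg : ∀ i, i + 2 ≤ n → g i + g (i + 2) = β * g (i + 1))
    (hf' : ∀ i j, i + j = n → f i + f j = 0) (hg' : ∀ i j, i + j = n → g i + g j = 0)
    (hf0 : ∀ i, i + i = n → f i = 0) (hg0 : ∀ i, i + i = n → g i = 0) {a : ℕ} (ha : a ≤ n) :
    f a * g 0 = f 0 * g a := by
  -- The discrete Wronskian is constant, and antisymmetry makes it zero at the middle. For even `n`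
  -- the vanishing at the midpoint is a separate hypothesis, since f m + f m = 0 does not give it in
  -- characteristic 2.
  have hW : ∀ i, i + 1 ≤ n → f i * g (i + 1) - f (i + 1) * g i = f 0 * g 1 - f 1 * g 0 := by
    intro i hi
    induction i with
    | zero => rfl
    | succ i ih =>
      rw [← ih (by omega)]
      linear_combination f (i + 1) * hg i hi - g (i + 1) * hf i hi
  have hW0 : 1 ≤ n → f 0 * g 1 - f 1 * g 0 = 0 := by
    intro hn
    obtain ⟨m, hm⟩ := Nat.even_or_odd' n
    rcases hm with hm | hm
    · rw [← hW m (by omega), hf0 m (by omega), hg0 m (by omega)]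
      ring
    · rw [← hW m (by omega)]
      linear_combination f m * hg' m (m + 1) (by omega) - g m * hf' m (m + 1) (by omega)
  suffices h : ∀ a, (a ≤ n → f a * g 0 = f 0 * g a) ∧
      (a + 1 ≤ n → f (a + 1) * g 0 = f 0 * g (a + 1)) from (h a).1 ha
  intro a
  induction a with
  | zero => exact ⟨fun _ => rfl, fun h => by linear_combination -hW0 h⟩
  | succ a ih =>
    refine ⟨ih.2, fun h => ?_⟩
    linear_combination g 0 * hf a h - f 0 * hg a h - ih.1 (by omega) + β * ih.2 (by omega)

section

variable {θ : ℕ → K} {β γ : K} {d : ℕ}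
  (hθ : ∀ i, i + 2 ≤ d → θ i + θ (i + 2) = β * θ (i + 1) + γ)
include hθ

theorem sub_reflect_recurrence {n : ℕ} (hn : n ≤ d) {i : ℕ} (hi : i + 2 ≤ n) :
    (θ i - θ (n - i)) + (θ (i + 2) - θ (n - (i + 2))) =
      β * (θ (i + 1) - θ (n - (i + 1))) := by
  have h := hθ (n - (i + 2)) (by omega)
  rw [show n - (i + 2) + 2 = n - i by omega, show n - (i + 2) + 1 = n - (i + 1) by omega] at h
  linear_combination hθ i (by omega) - h

theorem reflectedSum_window_recurrence {t i : ℕ} (hi : i + 2 + t ≤ d) :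
    (reflectedSum θ d (i + t + 1) - reflectedSum θ d i) +
      (reflectedSum θ d (i + 2 + t + 1) - reflectedSum θ d (i + 2)) =
      β * (reflectedSum θ d (i + 1 + t + 1) - reflectedSum θ d (i + 1)) := by
  induction t with
  | zero =>
    have h := sub_reflect_recurrence hθ le_rfl (show i + 2 ≤ d by omega)
    simp only [add_zero, reflectedSum_succ] at *
    linear_combination h
  | succ t ih =>
    have h := sub_reflect_recurrence hθ le_rfl (show i + t + 1 + 2 ≤ d by omega)
    have ih' := ih (by omega)
    rw [show i + (t + 1) + 1 = i + t + 1 + 1 by ring,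
      show i + 2 + (t + 1) + 1 = i + 2 + t + 1 + 1 by ring,
      show i + 1 + (t + 1) + 1 = i + 1 + t + 1 + 1 by ring, reflectedSum_succ _ _ (i + t + 1),
      reflectedSum_succ _ _ (i + 2 + t + 1), reflectedSum_succ _ _ (i + 1 + t + 1)]
    rw [show i + t + 1 + 2 = i + 2 + t + 1 by ring,
      show i + t + 1 + 1 = i + 1 + t + 1 by ring] at h
    linear_combination h + ih'

/-- With `t` fixed, both θ_a - θ_{d-t-a} and the window sum from `a` to `a + t` solve the
homogeneous recurrence in `a` and are antisymmetric about (d-t)/2. Proportionality is evaluated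
against a = 0. -/
theorem sub_mul_reflectedSum {a t : ℕ} (hat : a + t ≤ d) :
    (θ a - θ (d - a - t)) * reflectedSum θ d (t + 1) =
      (θ 0 - θ (d - t)) * (reflectedSum θ d (a + t + 1) - reflectedSum θ d a) := by
  have key := mul_eq_mul_of_antisymmetric (β := β) (n := d - t)
    (f := fun a => θ a - θ (d - t - a))
    (g := fun a => reflectedSum θ d (a + t + 1) - reflectedSum θ d a) (a := a)
    (fun i hi => sub_reflect_recurrence hθ (Nat.sub_le d t) hi)
    (fun i hi => reflectedSum_window_recurrence hθ (by omega))
    (fun i j hij => by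
      rw [show d - t - i = j by omega, show d - t - j = i by omega]
      ring)
    (fun i j hij => by
      rw [reflectedSum_symm θ (show i + t + 1 + j = d + 1 by omega),
        reflectedSum_symm θ (show j + t + 1 + i = d + 1 by omega)]
      ring)
    (fun i hi => by
      rw [show d - t - i = i by omega, sub_self])
    (fun i hi => by
      rw [reflectedSum_symm θ (show i + t + 1 + i = d + 1 by omega), sub_self]) (by omega)
  simpa [reflectedSum_zero, Nat.sub_right_comm] using key

end

/-- The solution of `u (n+2) = β u (n+1) - u n` with `u 0 = 0` and `u 1 = 1`. -/
def recurrenceUnit (β : K) : ℕ → K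
  | 0 => 0
  | 1 => 1
  | n + 2 => β * recurrenceUnit β (n + 1) - recurrenceUnit β n

theorem recurrenceUnit_add_two (β : K) (n : ℕ) :
    recurrenceUnit β (n + 2) = β * recurrenceUnit β (n + 1) - recurrenceUnit β n := rfl

/-- In a difference symmetric about a centre the constant γ cancels, so it solves the homogeneous
recurrence in `k` and is fixed by its first two values. The next lemma treats a centre halfway
between two indices. -/
theorem sub_eq_recurrenceUnit_mul {f : ℕ → K} {β γ : K} {d : ℕ}
    (hf : ∀ i, i + 2 ≤ d → f i + f (i + 2) = β * f (i + 1) + γ) {c k : ℕ} (hk : k ≤ c + 1)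
    (hcd : c + 1 + k ≤ d) :
    f (c + 1 + k) - f (c + 1 - k) = recurrenceUnit β k * (f (c + 2) - f c) := by
  induction k using Nat.twoStepInduction with
  | zero => simp [recurrenceUnit]
  | one => simp [recurrenceUnit]
  | more k ih₁ ih₂ =>
    have h₁ := hf (c + 1 + k) (by omega)
    have h₂ := hf (c + 1 - (k + 2)) (by omega)
    rw [show c + 1 - (k + 2) + 2 = c + 1 - k by omega,
      show c + 1 - (k + 2) + 1 = c + 1 - (k + 1) by omega] at h₂
    have e₁ := ih₁ (by omega) (by omega)
    have e₂ := ih₂ (by omega) (by omega)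
    rw [recurrenceUnit_add_two]
    rw [← add_assoc] at e₂ ⊢
    linear_combination h₁ - h₂ - e₁ + β * e₂

theorem sub_eq_recurrenceUnit_add_mul {f : ℕ → K} {β γ : K} {d : ℕ}
    (hf : ∀ i, i + 2 ≤ d → f i + f (i + 2) = β * f (i + 1) + γ) {c k : ℕ} (hk : k ≤ c)
    (hcd : c + 1 + k ≤ d) :
    f (c + 1 + k) - f (c - k) =
      (recurrenceUnit β (k + 1) + recurrenceUnit β k) * (f (c + 1) - f c) := by
  induction k using Nat.twoStepInduction with
  | zero => simp [recurrenceUnit]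
  | one =>
    obtain ⟨c, rfl⟩ : ∃ b, c = b + 1 := ⟨c - 1, by omega⟩
    have h₁ := hf (c + 1) (by omega)
    have h₂ := hf c (by omega)
    simp only [recurrenceUnit, Nat.add_sub_cancel, add_assoc, Nat.reduceAdd] at *
    linear_combination h₁ - h₂
  | more k ih₁ ih₂ =>
    have h₁ := hf (c + 1 + k) (by omega)
    have h₂ := hf (c - (k + 2)) (by omega)
    rw [show c - (k + 2) + 2 = c - k by omega,
      show c - (k + 2) + 1 = c - (k + 1) by omega] at h₂
    have e₁ := ih₁ (by omega) (by omega)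
    have e₂ := ih₂ (by omega) (by omega)
    have u₁ := recurrenceUnit_add_two β k
    have u₂ := recurrenceUnit_add_two β (k + 1)
    rw [show k + 1 + 2 = k + 2 + 1 by ring] at u₂
    rw [← add_assoc] at e₂ ⊢
    rw [show k + 1 + 1 = k + 2 by ring] at *
    linear_combination h₁ - h₂ - e₁ + β * e₂ - (f (c + 1) - f c) * (u₁ + u₂)

/-! ### Nonvanishing of the partial sums. -/

section

variable {θ : ℕ → K} {β γ : K} {d : ℕ}
  (hθ : ∀ i, i + 2 ≤ d → θ i + θ (i + 2) = β * θ (i + 1) + γ)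
include hθ

theorem reflectedSum_recurrence :
    ∀ i, i + 2 ≤ d + 1 → reflectedSum θ d i + reflectedSum θ d (i + 2) =
      β * reflectedSum θ d (i + 1) + (2 - β) * reflectedSum θ d 1 +
        (reflectedSum θ d 2 - 2 * reflectedSum θ d 1) := by
  intro i hi
  induction i with
  | zero => rw [reflectedSum_zero]; ring
  | succ i ih =>
    have h := sub_reflect_recurrence hθ le_rfl (show i + 2 ≤ d by omega)
    have h₁ := reflectedSum_succ θ d i
    have h₂ := reflectedSum_succ θ d (i + 1)
    have h₃ := reflectedSum_succ θ d (i + 2)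
    rw [show i + 1 + 2 = i + 2 + 1 by ring]
    rw [show i + 1 + 1 = i + 2 by ring] at *
    linear_combination ih (by omega) + h + h₁ + h₃ - β * h₂

variable (hinj : Set.InjOn θ (Set.Iic d))
include hinj

/-- It is a factor of θ_{2k} - θ_0, a difference of distinct eigenvalues. -/
theorem recurrenceUnit_ne_zero {k : ℕ} (hk : 1 ≤ k) (hkd : 2 * k ≤ d) :
    recurrenceUnit β k ≠ 0 := by
  intro h
  have := sub_eq_recurrenceUnit_mul hθ (c := k - 1) (k := k) (by omega) (by omega)
  rw [h, zero_mul, sub_eq_zero] at this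
  have := hinj (by simp only [Set.mem_Iic]; omega) (by simp only [Set.mem_Iic]; omega) this
  omega

theorem recurrenceUnit_add_ne_zero {k : ℕ} (hkd : 2 * k + 1 ≤ d) :
    recurrenceUnit β (k + 1) + recurrenceUnit β k ≠ 0 := by
  intro h
  have := sub_eq_recurrenceUnit_add_mul hθ (c := k) (k := k) (by omega) (by omega)
  rw [h, zero_mul, sub_eq_zero] at this
  have := hinj (by simp only [Set.mem_Iic]; omega) (by simp only [Set.mem_Iic]; omega) this
  omega

/-- The sums satisfy the same kind of recurrence as θ and start at 0. Hence the value at 2m + 1 is a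
symmetric difference, equal to a nonzero factor times θ_m - θ_{d-m}. -/
theorem reflectedSum_odd_ne_zero {m : ℕ} (hm : 2 * m + 1 ≤ d) :
    reflectedSum θ d (2 * m + 1) ≠ 0 := by
  have hS : ∀ i, i + 2 ≤ d + 1 → reflectedSum θ d i + reflectedSum θ d (i + 2) =
      β * reflectedSum θ d (i + 1) + ((2 - β) * reflectedSum θ d 1 +
        (reflectedSum θ d 2 - 2 * reflectedSum θ d 1)) := fun i hi => by
    rw [reflectedSum_recurrence hθ i hi]; ring
  have h := sub_eq_recurrenceUnit_add_mul hS (c := m) (k := m) le_rfl (by omega)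
  rw [Nat.sub_self, reflectedSum_zero, sub_zero, reflectedSum_succ θ d m, add_sub_cancel_left,
    show m + 1 + m = 2 * m + 1 by ring] at h
  rw [h]
  refine mul_ne_zero (recurrenceUnit_add_ne_zero hθ hinj hm) (sub_ne_zero.2 fun e => ?_)
  have := hinj (by simp only [Set.mem_Iic]; omega) (by simp only [Set.mem_Iic]; omega) e
  omega

theorem reflectedSum_even_ne_zero {m l : ℕ} (hd : d = 2 * l + 1) (hβ : β + 2 ≠ 0) (hm : 1 ≤ m)
    (hml : m ≤ l) : reflectedSum θ d (2 * m) ≠ 0 := by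
  have hS : ∀ i, i + 2 ≤ d + 1 → reflectedSum θ d i + reflectedSum θ d (i + 2) =
      β * reflectedSum θ d (i + 1) + ((2 - β) * reflectedSum θ d 1 +
        (reflectedSum θ d 2 - 2 * reflectedSum θ d 1)) := fun i hi => by
    rw [reflectedSum_recurrence hθ i hi]; ring
  obtain ⟨m, rfl⟩ : ∃ b, m = b + 1 := ⟨m - 1, by omega⟩
  have h := sub_eq_recurrenceUnit_mul hS (c := m) (k := m + 1) le_rfl (by omega)
  rw [Nat.sub_self, reflectedSum_zero, sub_zero, show m + 2 = m + 1 + 1 by ring,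
    reflectedSum_succ θ d (m + 1), reflectedSum_succ θ d m,
    show m + 1 + (m + 1) = 2 * (m + 1) by ring] at h
  have e₁ := sub_eq_recurrenceUnit_add_mul hθ (c := l) (k := l - m) (by omega) (by omega)
  have e₂ := sub_eq_recurrenceUnit_add_mul hθ (c := l) (k := l - (m + 1)) (by omega) (by omega)
  rw [show l + 1 + (l - m) = d - m by omega, show l - (l - m) = m by omega] at e₁
  rw [show l + 1 + (l - (m + 1)) = d - (m + 1) by omega,
    show l - (l - (m + 1)) = m + 1 by omega] at e₂
  obtain ⟨k, hk⟩ : ∃ k, l - (m + 1) = k := ⟨_, rfl⟩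
  rw [show l - m = k + 1 by omega] at e₁
  rw [hk] at e₂
  have hu := recurrenceUnit_add_two β k
  -- Expanding θ_m - θ_{d-m} and θ_{m+1} - θ_{d-m-1} about the centre of the odd diameter gives
  -- u_{k+2} + 2u_{k+1} + u_k = (β + 2)u_{k+1}. This is where β = -2 must be excluded.
  have hprod : reflectedSum θ d (2 * (m + 1)) = recurrenceUnit β (m + 1) *
      ((β + 2) * recurrenceUnit β (k + 1) * (θ l - θ (l + 1))) := by
    rw [h, ← sub_eq_zero]
    rw [show k + 1 + 1 = k + 2 by ring, hu] at e₁
    linear_combination recurrenceUnit β (m + 1) * (-e₁ - e₂)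
  rw [hprod]
  refine mul_ne_zero (recurrenceUnit_ne_zero hθ hinj (by omega) (by omega))
    (mul_ne_zero (mul_ne_zero hβ (recurrenceUnit_ne_zero hθ hinj (by omega) (by omega)))
      (sub_ne_zero.2 fun e => ?_))
  have := hinj (by simp only [Set.mem_Iic]; omega) (by simp only [Set.mem_Iic]; omega) e
  omega

theorem reflectedSum_ne_zero (hβ : Even d ∨ β + 2 ≠ 0) {i : ℕ} (hi : 1 ≤ i) (hid : i ≤ d) :
    reflectedSum θ d i ≠ 0 := by
  obtain ⟨m, rfl | rfl⟩ := Nat.even_or_odd' i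
  · rcases Nat.even_or_odd' d with ⟨l, hd | hd⟩
    -- For even `d` the reflection i ↦ d + 1 - i turns an even index into an odd one.
    · rw [reflectedSum_symm θ (show 2 * m + (2 * (l - m) + 1) = d + 1 by omega)]
      exact reflectedSum_odd_ne_zero hθ hinj (by omega)
    · refine reflectedSum_even_ne_zero hθ hinj hd (hβ.resolve_left fun h => ?_) (by omega)
        (by omega)
      obtain ⟨k, hk⟩ := h
      omega
  · exact reflectedSum_odd_ne_zero hθ hinj hid

end

end RecurrentSequences

/-! ### Weighted lowering maps and the expansion of η in terms of τ. -/

section Ladders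

variable {K : Type*} [Field K]

/-- The product of `ϑ (i+m+t) - ϑ i` over `t < k`. -/
def ladderProd (ϑ : ℕ → K) (i k m : ℕ) : K := ∏ t ∈ Finset.range k, (ϑ (i + m + t) - ϑ i)

theorem ladderProd_succ (ϑ : ℕ → K) (i k m : ℕ) :
    ladderProd ϑ i (k + 1) m = ladderProd ϑ i k m * (ϑ (i + m + k) - ϑ i) :=
  Finset.prod_range_succ _ _

theorem ladderProd_succ' (ϑ : ℕ → K) (i k m : ℕ) :
    ladderProd ϑ i (k + 1) m = ladderProd ϑ i k (m + 1) * (ϑ (i + m) - ϑ i) := by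
  rw [ladderProd, Finset.prod_range_succ', add_zero, ladderProd]
  congr 1
  refine Finset.prod_congr rfl fun t _ => ?_
  congr 2
  ring

/-- The coefficients expressing `Δ` as a polynomial in `Ψ`. -/
noncomputable def ladderCoeff (θ ϑ : ℕ → K) (d k : ℕ) : K :=
  (rootProd (fun n => θ (d - n)) 0 k).eval (θ 0) / ∏ i ∈ Finset.Icc 1 k, ϑ i

theorem ladderCoeff_zero (θ ϑ : ℕ → K) (d : ℕ) : ladderCoeff θ ϑ d 0 = 1 := by
  simp [ladderCoeff, rootProd_self]

theorem ladderCoeff_succ (θ ϑ : ℕ → K) (d k : ℕ) :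
    ladderCoeff θ ϑ d (k + 1) = ladderCoeff θ ϑ d k * ((θ 0 - θ (d - k)) / ϑ (k + 1)) := by
  rw [ladderCoeff, ladderCoeff, rootProd_succ _ (Nat.zero_le k), eval_mul,
    Finset.prod_Icc_succ_top (by omega), mul_div_mul_comm]
  simp

/-- Expansion of the polynomials with reversed roots in terms of those with the given roots. -/
theorem rootProd_reverse_eq_sum {θ ϑ : ℕ → K} {d : ℕ}
    (hϑ : ∀ a t, a + t ≤ d →
      (θ a - θ (d - a - t)) * ϑ (t + 1) = (θ 0 - θ (d - t)) * (ϑ (a + t + 1) - ϑ a))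
    (hne : ∀ i, 1 ≤ i → i ≤ d → ϑ i ≠ 0) (i n : ℕ) (hn : i + n ≤ d) :
    rootProd (fun n => θ (d - n)) i (i + n) = ∑ p ∈ Finset.HasAntidiagonal.antidiagonal n,
      C (ladderCoeff θ ϑ d p.1 * ladderProd ϑ i p.1 (p.2 + 1)) * rootProd θ i (i + p.2) := by
  induction n with
  | zero => simp [rootProd_self, ladderCoeff_zero, ladderProd]
  | succ n ih =>
    -- Multiplying by X - θ_{d-i-n} = (X - θ_{i+m}) + (θ_{i+m} - θ_{d-i-n}) either raises `m` or
    -- raises `k`. The coefficient at level `n + 1` is split into these two contributions.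
    have hsplit : ∀ p : ℕ × ℕ,
        C (ladderCoeff θ ϑ d p.1 * ladderProd ϑ i p.1 (p.2 + 1)) * rootProd θ i (i + p.2) =
        C (ladderCoeff θ ϑ d p.1 * ladderProd ϑ i p.1 p.2) * rootProd θ i (i + p.2) +
        C (ladderCoeff θ ϑ d p.1 * (ladderProd ϑ i p.1 (p.2 + 1) - ladderProd ϑ i p.1 p.2)) *
          rootProd θ i (i + p.2) := by
      intro p
      rw [← add_mul, ← C_add]
      ring_nf
    rw [← add_assoc, rootProd_succ _ (by omega), ih (by omega), Finset.sum_congr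
      (s₁ := Finset.HasAntidiagonal.antidiagonal (n + 1)) rfl fun p _ => hsplit p, Finset.sum_add_distrib, Finset.Nat.sum_antidiagonal_succ',
      Finset.Nat.sum_antidiagonal_succ, Finset.sum_mul]
    have h₁ : ladderProd ϑ i (n + 1) 0 = 0 := by
      rw [ladderProd_succ', add_zero, sub_self, mul_zero]
    have h₂ : ∀ m, ladderProd ϑ i 0 m = 1 := fun m => rfl
    simp only [h₁, h₂, sub_self, mul_zero, C_0, zero_mul, zero_add]
    rw [← Finset.sum_add_distrib]
    refine Finset.sum_congr rfl fun p hp => ?_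
    obtain ⟨k, m⟩ := p
    rw [Finset.HasAntidiagonal.mem_antidiagonal] at hp
    dsimp only at hp ⊢
    subst hp
    have hs := hϑ (i + m) k (by omega)
    have hk := hne (k + 1) (by omega) (by omega)
    have hc : ladderCoeff θ ϑ d (k + 1) *
        (ladderProd ϑ i (k + 1) (m + 1) - ladderProd ϑ i (k + 1) m) =
        ladderCoeff θ ϑ d k * ladderProd ϑ i k (m + 1) * (θ (i + m) - θ (d - (i + m) - k)) := by
      rw [ladderCoeff_succ, ladderProd_succ, ladderProd_succ', ← mul_sub, sub_sub_sub_cancel_right,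
        show i + (m + 1) + k = i + m + k + 1 by ring]
      field_simp
      linear_combination -(ladderCoeff θ ϑ d k * ladderProd ϑ i k (m + 1)) * hs
    rw [hc, show d - (i + (k + m)) = d - (i + m) - k by omega, ← add_assoc i m 1,
      rootProd_succ θ (Nat.le_add_right i m)]
    simp only [C_mul, C_sub]
    ring

variable {V : Type*} [AddCommGroup V] [Module K V]

section

variable {ϑ : ℕ → K} {P : Module.End K V} {i n : ℕ} {x : ℕ → V} (h0 : P (x 0) = 0)
  (hx : ∀ m < n, P (x (m + 1)) = (ϑ (i + m + 1) - ϑ i) • x m)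
include hx

theorem pow_apply_ladder {k m : ℕ} (hkm : k + m ≤ n) :
    (P ^ k) (x (k + m)) = ladderProd ϑ i k (m + 1) • x m := by
  induction k with
  | zero => simp [ladderProd]
  | succ k ih =>
    rw [pow_succ, Module.End.mul_apply, show k + 1 + m = k + m + 1 by ring, hx _ (by omega),
      map_smul, ih (by omega), smul_smul, ladderProd_succ, mul_comm]
    congr 4
    ring

include h0

theorem pow_apply_ladder_eq_zero {k : ℕ} (hk : n < k) : (P ^ k) (x n) = 0 := by
  obtain ⟨l, rfl⟩ : ∃ l, k = l + 1 + n := ⟨k - n - 1, by omega⟩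
  have h := pow_apply_ladder hx (k := n) (m := 0) (by omega)
  rw [add_zero] at h
  rw [pow_add, Module.End.mul_apply, h, map_smul, pow_succ, Module.End.mul_apply, h0, map_zero,
    smul_zero]

theorem sum_pow_apply_ladder (g : ℕ → K) {d : ℕ} (hn : n ≤ d) :
    (∑ k ∈ Finset.range (d + 1), g k • P ^ k) (x n) =
      ∑ p ∈ Finset.HasAntidiagonal.antidiagonal n, (g p.1 * ladderProd ϑ i p.1 (p.2 + 1)) • x p.2 := by
  rw [LinearMap.sum_apply, Finset.Nat.sum_antidiagonal_eq_sum_range_succ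
    (fun k m => (g k * ladderProd ϑ i k (m + 1)) • x m)]
  symm
  refine Finset.sum_subset_zero_on_sdiff (Finset.range_mono (by omega)) (fun k hk => ?_)
    fun k hk => ?_
  · simp only [Finset.mem_sdiff, Finset.mem_range] at hk
    rw [LinearMap.smul_apply, pow_apply_ladder_eq_zero h0 hx (by omega), smul_zero]
  · rw [Finset.mem_range] at hk
    have h := pow_apply_ladder hx (k := k) (m := n - k) (by omega)
    rw [show k + (n - k) = n by omega] at h
    rw [LinearMap.smul_apply, h, smul_smul]

/-- The sum is a polynomial in `P` applied to a ladder vector, and `P` commutes with that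
polynomial. -/
theorem apply_sum_ladder (g : ℕ → K) {m : ℕ} (hm : m < n) :
    P (∑ p ∈ Finset.HasAntidiagonal.antidiagonal (m + 1), (g p.1 * ladderProd ϑ i p.1 (p.2 + 1)) • x p.2) =
      (ϑ (i + m + 1) - ϑ i) •
        ∑ p ∈ Finset.HasAntidiagonal.antidiagonal m, (g p.1 * ladderProd ϑ i p.1 (p.2 + 1)) • x p.2 := by
  rw [map_sum, Finset.Nat.sum_antidiagonal_succ', Finset.smul_sum]
  simp only [map_smul, h0, smul_zero, zero_add]
  refine Finset.sum_congr rfl fun p hp => ?_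
  obtain ⟨k, l⟩ := p
  rw [Finset.HasAntidiagonal.mem_antidiagonal] at hp
  dsimp only at hp ⊢
  subst hp
  have e : ladderProd ϑ i k (l + 1 + 1) * (ϑ (i + l + 1) - ϑ i) =
      (ϑ (i + (k + l) + 1) - ϑ i) * ladderProd ϑ i k (l + 1) := by
    rw [add_assoc i l 1, ← ladderProd_succ', ladderProd_succ, mul_comm]
    congr 3
    ring
  rw [hx l (by omega), smul_smul, smul_smul, mul_assoc, e]
  congr 1
  ring

end

namespace IsTridiagonalData

variable {A B : Module.End K V} {d : ℕ} {θ θs ϑ : ℕ → K}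

/-- `P` lowers the refined split decomposition with the weights given by `ϑ`. -/
def IsLowering (A B : Module.End K V) (d : ℕ) (θ θs ϑ : ℕ → K) (P : Module.End K V) : Prop :=
  ∀ i j : ℕ, i ≤ j → i + j ≤ d → ∀ v ∈ splitKernel A B d θ θs i,
    P (aeval A (rootProd θ i j) v) = (ϑ j - ϑ i) • aeval A (rootProd θ i (j - 1)) v

theorem IsLowering.apply_zero {P : Module.End K V} (hP : IsLowering A B d θ θs ϑ P) {i : ℕ}
    (hi : i + i ≤ d) {v : V} (hv : v ∈ splitKernel A B d θ θs i) :
    P (aeval A (rootProd θ i (i + 0)) v) = 0 := by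
  rw [add_zero, hP i i le_rfl hi v hv, sub_self, zero_smul]

theorem IsLowering.apply_succ {P : Module.End K V} (hP : IsLowering A B d θ θs ϑ P) {i n : ℕ}
    (hi : i + (i + n) ≤ d) {v : V} (hv : v ∈ splitKernel A B d θ θs i) :
    ∀ m < n, P (aeval A (rootProd θ i (i + (m + 1))) v) =
      (ϑ (i + m + 1) - ϑ i) • aeval A (rootProd θ i (i + m)) v := fun m hm => by
  rw [← add_assoc, hP i (i + m + 1) (by omega) (by omega) v hv, Nat.add_sub_cancel]

theorem splitKernel_reverse (A B : Module.End K V) (θ θs : ℕ → K) {i : ℕ} :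
    splitKernel A B d (fun n => θ (d - n)) θs i = splitKernel A B d θ θs i := by
  rw [splitKernel, splitKernel]
  congr 1
  rcases le_or_gt (i + i) d with h | h
  · rw [spectralSum, rootProd_reflect θ (by omega), Nat.sub_sub_self (by omega), spectralSum]
  · rw [spectralSum_self _ _ (by omega), spectralSum_self _ _ (by omega)]

section

variable (hϑ : ∀ a t, a + t ≤ d →
      (θ a - θ (d - a - t)) * ϑ (t + 1) = (θ 0 - θ (d - t)) * (ϑ (a + t + 1) - ϑ a))
    (hne : ∀ i, 1 ≤ i → i ≤ d → ϑ i ≠ 0)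
include hϑ hne

theorem aeval_rootProd_reverse {i n : ℕ} (hi : i + n ≤ d) (v : V) :
    aeval A (rootProd (fun n => θ (d - n)) i (i + n)) v = ∑ p ∈ Finset.HasAntidiagonal.antidiagonal n,
      (ladderCoeff θ ϑ d p.1 * ladderProd ϑ i p.1 (p.2 + 1)) •
        aeval A (rootProd θ i (i + p.2)) v := by
  rw [rootProd_reverse_eq_sum hϑ hne i n hi, map_sum, LinearMap.sum_apply]
  simp only [map_mul, aeval_C, Module.End.mul_apply, Module.algebraMap_end_apply, mul_smul]

theorem IsLowering.sum_pow_apply {P : Module.End K V} (hP : IsLowering A B d θ θs ϑ P) {i j : ℕ}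
    (hij : i ≤ j) (hd : i + j ≤ d) {v : V} (hv : v ∈ splitKernel A B d θ θs i) :
    (∑ k ∈ Finset.range (d + 1), ladderCoeff θ ϑ d k • P ^ k) (aeval A (rootProd θ i j) v) =
      aeval A (rootProd (fun n => θ (d - n)) i j) v := by
  obtain ⟨n, rfl⟩ := Nat.exists_eq_add_of_le hij
  rw [aeval_rootProd_reverse hϑ hne (by omega)]
  exact sum_pow_apply_ladder (x := fun m => aeval A (rootProd θ i (i + m)) v)
    (hP.apply_zero (by omega) hv) (hP.apply_succ hd hv) _ (by omega)

/-- The reversed ladder is the image of the original one under a polynomial in `P`, so `P` descends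
it with the same weights. This makes the formula for the inverse an instance of the formula for Δ.
-/
theorem IsLowering.reverse {P : Module.End K V} (hP : IsLowering A B d θ θs ϑ P) :
    IsLowering A B d (fun n => θ (d - n)) θs ϑ P := by
  intro i j hij hd v hv
  rw [splitKernel_reverse] at hv
  obtain ⟨n, rfl⟩ := Nat.exists_eq_add_of_le hij
  cases n with
  | zero =>
    have h := hP.apply_zero (by omega) hv
    rw [add_zero, rootProd_self] at *
    rw [h, sub_self, zero_smul]
  | succ n =>
    rw [aeval_rootProd_reverse hϑ hne (by omega), ← add_assoc, Nat.add_sub_cancel,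
      aeval_rootProd_reverse hϑ hne (by omega)]
    exact apply_sum_ladder (x := fun m => aeval A (rootProd θ i (i + m)) v)
      (hP.apply_zero (by omega) hv) (hP.apply_succ hd hv) _ (Nat.lt_succ_self n)

end

end IsTridiagonalData

end Ladders

/-! ### Direct sums, projections, and the action of Δ. -/

section Reversal

variable {K V : Type*} [Field K] [AddCommGroup V] [Module K V]

theorem rootProd_reverse_reverse (θ : ℕ → K) {a b d : ℕ} (h : b ≤ d + 1) :
    rootProd (fun n => θ (d - (d - n))) a b = rootProd θ a b :=
  Finset.prod_congr rfl fun n hn => congrArg (fun m => X - C (θ m))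
    (Nat.sub_sub_self (by have := Finset.mem_Ico.1 hn; omega))

theorem reflectedSum_reverse (θ : ℕ → K) {d i : ℕ} (h : i ≤ d + 1) :
    reflectedSum (fun n => θ (d - n)) d i = -reflectedSum θ d i := by
  rw [reflectedSum, reflectedSum, ← Finset.sum_neg_distrib]
  refine Finset.sum_congr rfl fun n hn => ?_
  rw [Nat.sub_sub_self (by have := Finset.mem_range.1 hn; omega), neg_sub]

theorem reverse_recurrence {θ : ℕ → K} {β γ : K} {d : ℕ}
    (hθ : ∀ i, i + 2 ≤ d → θ i + θ (i + 2) = β * θ (i + 1) + γ) (i : ℕ) (hi : i + 2 ≤ d) :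
    θ (d - i) + θ (d - (i + 2)) = β * θ (d - (i + 1)) + γ := by
  have h := hθ (d - (i + 2)) (by omega)
  rw [show d - (i + 2) + 2 = d - i by omega, show d - (i + 2) + 1 = d - (i + 1) by omega] at h
  rw [← h, add_comm]

namespace IsTridiagonalData

variable {A B : Module.End K V} {d : ℕ} {θ θs ϑ : ℕ → K}

theorem isInternal_splitComponent (D : IsTridiagonalData A B d θ θs) :
    DirectSum.IsInternal fun i : Fin (d + 1) => splitComponent A B d θ θs i := by
  rw [DirectSum.isInternal_submodule_iff_iSupIndep_and_iSup_eq_top]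
  constructor
  · intro i
    rw [Submodule.disjoint_def]
    intro x hx hx'
    have hle : (⨆ (j : Fin (d + 1)) (_ : j ≠ i), splitComponent A B d θ θs j) ≤
        spectralSum B θs 0 i ⊔ spectralSum A θ (i + 1) (d + 1) := by
      refine iSup₂_le fun j hj => ?_
      have hj' : (j : ℕ) ≠ i := fun h => hj (Fin.ext h)
      rcases lt_or_gt_of_ne hj' with h | h
      · exact inf_le_left.trans ((spectralSum_mono B θs le_rfl h).trans le_sup_left)
      · exact inf_le_right.trans ((spectralSum_mono A θ h le_rfl).trans le_sup_right)
    obtain ⟨a, ha, b, hb, rfl⟩ := Submodule.mem_sup.1 (hle hx')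
    have hb0 : b = 0 := by
      refine D.eq_zero_of_mem_of_mem (r := i + 1) ?_ hb
      rw [← add_sub_cancel_left a b]
      exact Submodule.sub_mem _ hx.1 (spectralSum_mono B θs le_rfl (Nat.le_succ _) ha)
    rw [hb0, add_zero] at hx ⊢
    exact D.eq_zero_of_mem_of_mem ha hx.2
  · rw [← top_le_iff, ← D.iSup_splitComponent]
    refine iSup_le fun j => ?_
    rcases lt_or_ge d j with h | h
    · rw [splitComponent_eq_bot A B θ θs h]
      exact bot_le
    · exact le_iSup (fun i : Fin (d + 1) => splitComponent A B d θ θs i) ⟨j, by omega⟩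

/-- The map `Δ` transforms the refined split decomposition into the one for the reversed
ordering. -/
theorem sum_projection_apply (D : IsTridiagonalData A B d θ θs)
    (hϑ : ∀ a t, a + t ≤ d → (θ (d - a) - θ (d - (d - a - t))) * ϑ (t + 1) =
      (θ (d - 0) - θ (d - (d - t))) * (ϑ (a + t + 1) - ϑ a))
    (hne : ∀ i, 1 ≤ i → i ≤ d → ϑ i ≠ 0) {F G : Fin (d + 1) → Module.End K V}
    (hF : ∀ i j : Fin (d + 1), ∀ x ∈ splitComponent A B d θ θs j, F i x = if i = j then x else 0)
    (hG : ∀ i j : Fin (d + 1), ∀ x ∈ splitComponent A B d (fun n => θ (d - n)) θs j,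
      G i x = if i = j then x else 0) {i j : ℕ} (hij : i ≤ j) (hd : i + j ≤ d) {v : V}
    (hv : v ∈ splitKernel A B d θ θs i) :
    (∑ h, G h * F h) (aeval A (rootProd θ i j) v) =
      aeval A (rootProd (fun n => θ (d - n)) i j) v := by
  obtain ⟨n, rfl⟩ := Nat.exists_eq_add_of_le hij
  have hFx := fun h => hF h ⟨i + n, by omega⟩ _ (D.aeval_mem_of_mem_splitKernel hij hv)
  rw [LinearMap.sum_apply, Finset.sum_eq_single ⟨i + n, by omega⟩]
  rotate_left
  · intro h _ hne
    rw [Module.End.mul_apply, hFx, if_neg hne, map_zero]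
  · intro h
    exact absurd (Finset.mem_univ _) h
  -- The τ-vector is expanded in η-vectors, each lying in its own reversed component. Only the top
  -- term `(0, n)`, with coefficient 1, survives the projection.
  rw [Module.End.mul_apply, hFx, if_pos rfl, ← rootProd_reverse_reverse θ (d := d) (by omega),
    aeval_rootProd_reverse (θ := fun n => θ (d - n)) hϑ hne (by omega), map_sum,
    Finset.sum_eq_single (0, n)]
  · rw [map_smul, hG _ ⟨i + n, by omega⟩ _ (D.reverse.aeval_mem_of_mem_splitKernel hij
      (by rwa [splitKernel_reverse])), if_pos rfl, ladderCoeff_zero]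
    simp [ladderProd]
  · rintro ⟨k, m⟩ hp hkm
    rw [Finset.HasAntidiagonal.mem_antidiagonal] at hp
    dsimp only at hp ⊢
    have hmn : m ≠ n := by
      rintro rfl
      exact hkm (by rw [show k = 0 by omega])
    rw [map_smul, hG _ ⟨i + m, by omega⟩ _ (D.reverse.aeval_mem_of_mem_splitKernel
      (Nat.le_add_right i m) (by rwa [splitKernel_reverse])), if_neg, smul_zero]
    intro h
    have := congrArg Fin.val h
    dsimp only at this
    omega
  · intro h
    exact absurd (by simp) h

end IsTridiagonalData

theorem componentProjection_apply {d : ℕ} {U : Fin (d + 1) → Submodule K V}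
    (hU : DirectSum.IsInternal U) (i j : Fin (d + 1)) {x : V} (hx : x ∈ U j) :
    componentProjection U i x = if i = j then x else 0 := by
  rw [DirectSum.isInternal_submodule_iff_iSupIndep_and_iSup_eq_top] at hU
  have hc : IsCompl (U i) (⨆ (j : Fin (d + 1)) (_ : j ≠ i), U j) := by
    refine ⟨hU.1 i, codisjoint_iff_le_sup.2 (hU.2 ▸ iSup_le fun j => ?_)⟩
    rcases eq_or_ne j i with rfl | h
    · exact le_sup_left
    · exact (le_iSup₂ (f := fun (j : Fin (d + 1)) (_ : j ≠ i) => U j) j h).trans le_sup_right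
  rw [componentProjection, dif_pos hc]
  split_ifs with h
  · subst h
    exact Submodule.projection_apply_left hc ⟨x, hx⟩
  · exact (Submodule.projection_apply_eq_zero_iff hc).2
      (Submodule.mem_iSup_of_mem j (Submodule.mem_iSup_of_mem (Ne.symm h) hx))

theorem IsStandardOrdering.isTridiagonalAction {A B : Module.End K V} {d : ℕ}
    {W : Fin (d + 1) → Submodule K V} (hA : IsDiagonalizable A) (hW : IsStandardOrdering A B W)
    {θ : ℕ → K} (hθ : ∀ i : Fin (d + 1), W i = A.eigenspace (θ i)) :
    IsTridiagonalAction A B d θ where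
  injOn i hi j hj h := by
    have h' : W ⟨i, Nat.lt_succ_of_le hi⟩ = W ⟨j, Nat.lt_succ_of_le hj⟩ := by
      rw [hθ, hθ]
      exact congrArg _ h
    exact congrArg Fin.val (hW.1.1 h')
  aeval_eq_zero := by
    rw [← LinearMap.ker_eq_top, ← top_le_iff, ← (show ⨆ μ : K, A.eigenspace μ = ⊤ from hA)]
    refine iSup_le fun μ => ?_
    by_cases hμ : A.eigenspace μ = ⊥
    · rw [hμ]
      exact bot_le
    · have hmem : A.eigenspace μ ∈ {S | IsEigenspace A S} := ⟨hμ, μ, rfl⟩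
      rw [← hW.1.2] at hmem
      obtain ⟨i, hi⟩ := hmem
      rw [← hi, hθ]
      intro x hx
      rw [LinearMap.mem_ker, Module.End.aeval_apply_of_mem_apply_eq_smul
        (Module.End.mem_eigenspace_iff.1 hx), eval_rootProd θ (Nat.zero_le _) i.2, zero_smul]
  eigenspace_ne_bot i hi := by
    have h : W ⟨i, Nat.lt_succ_of_le hi⟩ ∈ {S | IsEigenspace A S} := hW.1.2 ▸ ⟨_, rfl⟩
    rw [hθ] at h
    exact h.1
  tridiagonal i hi v hv q hq := by
    have hvW : v ∈ W ⟨i, Nat.lt_succ_of_le hi⟩ := by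
      rw [hθ]
      exact Module.End.mem_eigenspace_iff.2 hv
    have hmem := hW.2 _ (Submodule.mem_map_of_mem (f := B) hvW)
    refine (?_ : _ ≤ LinearMap.ker (aeval A q)) hmem
    refine iSup₂_le fun j hj x hx => ?_
    rw [hθ, Module.End.mem_eigenspace_iff] at hx
    rw [LinearMap.mem_ker, Module.End.aeval_apply_of_mem_apply_eq_smul hx,
      hq j (Nat.le_of_lt_succ j.2) hj.1 hj.2, zero_smul]

theorem IsTridiagonalAction.iSup_eq_spectralSum {A B : Module.End K V} {d : ℕ} {θ : ℕ → K}
    (H : IsTridiagonalAction A B d θ) {W : Fin (d + 1) → Submodule K V}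
    (hW : ∀ i, W i = A.eigenspace (θ i)) {p : Fin (d + 1) → Prop} {a b : ℕ} (hb : b ≤ d + 1)
    (hp : ∀ j, p j ↔ a ≤ (j : ℕ) ∧ (j : ℕ) < b) :
    (⨆ (j : Fin (d + 1)) (_ : p j), W j) = spectralSum A θ a b := by
  rw [spectralSum_eq_iSup A H.injOn hb]
  refine le_antisymm (iSup₂_le fun j hj => ?_) (iSup₂_le fun j hj => ?_)
  · rw [hW]
    exact le_iSup₂ (f := fun (h : ℕ) (_ : h ∈ Finset.Ico a b) => A.eigenspace (θ h)) (j : ℕ)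
      (Finset.mem_Ico.2 ((hp j).1 hj))
  · rw [Finset.mem_Ico] at hj
    have h := le_iSup₂ (f := fun (j : Fin (d + 1)) (_ : p j) => W j) ⟨j, by omega⟩ ((hp _).2 hj)
    rwa [hW] at h

end Reversal

/-! ### Translation to tridiagonal systems. -/

namespace TDSystem

variable {K V : Type*} [Field K] [AddCommGroup V] [Module K V] {d : ℕ} (Φ : TDSystem K V d)

/-- The eigenvalues of `A`, indexed by the natural numbers. -/
noncomputable def eigenvalue (n : ℕ) : K := Φ.θ ⟨min n d, by omega⟩

theorem eigenvalue_val (i : Fin (d + 1)) : Φ.eigenvalue i = Φ.θ i := by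
  rw [eigenvalue]
  congr 1
  exact Fin.ext (min_eq_left (Nat.le_of_lt_succ i.2))

theorem eigenvalue_sub (i : Fin (d + 1)) : Φ.eigenvalue (d - i) = Φ.θ i.rev := by
  rw [← eigenvalue_val]
  congr 1
  rw [Fin.val_rev]
  omega

theorem range_E_eq (i : Fin (d + 1)) :
    LinearMap.range (Φ.E i) = Φ.A.eigenspace (Φ.eigenvalue i) := by
  rw [eigenvalue_val, Φ.range_E]

theorem exists_isTridiagonalData : ∃ θs : ℕ → K,
    IsTridiagonalData Φ.A Φ.Astar d Φ.eigenvalue θs ∧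
      ∀ i, LinearMap.range (Φ.Estar i) = Φ.Astar.eigenspace (θs i) := by
  have h : ∀ i, ∃ μ, LinearMap.range (Φ.Estar i) = Φ.Astar.eigenspace μ := by
    intro i
    have h : LinearMap.range (Φ.Estar i) ∈ {S | IsEigenspace Φ.Astar S} := by
      rw [← Φ.idempotents_star.1.1.2]
      exact ⟨i, rfl⟩
    exact h.2
  choose μ hμ using h
  have hμ' : ∀ i : Fin (d + 1), LinearMap.range (Φ.Estar i) =
      Φ.Astar.eigenspace (μ ⟨min i d, by omega⟩) := by
    intro i
    rw [hμ]
    congr 2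
    exact Fin.ext (min_eq_left (Nat.le_of_lt_succ i.2)).symm
  refine ⟨fun n => μ ⟨min n d, by omega⟩, ⟨?_, ?_, fun W h₁ h₂ => ?_⟩, hμ'⟩
  · exact Φ.idempotents.1.isTridiagonalAction Φ.pair.diagonalizable_left
      Φ.range_E_eq
  · exact Φ.idempotents_star.1.isTridiagonalAction Φ.pair.diagonalizable_right hμ'
  · by_contra! h
    exact Φ.pair.irreducible ⟨W, Submodule.map_le_iff_le_comap.2 h₁,
      Submodule.map_le_iff_le_comap.2 h₂, h.1, h.2⟩

theorem τ_eq {i j : ℕ} (h : j ≤ d + 1) : Φ.τ i j = rootProd Φ.eigenvalue i j := by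
  simp only [τ, ← eigenvalue_val]
  rw [Finset.prod_filter, Fin.prod_univ_eq_prod_range (fun h => if i ≤ h ∧ h < j then
    X - C (Φ.eigenvalue h) else 1) (d + 1), ← Finset.prod_filter, rootProd]
  refine Finset.prod_congr (Finset.ext fun h => ?_) fun _ _ => rfl
  simp only [Finset.mem_filter, Finset.mem_range, Finset.mem_Ico]
  omega

theorem η_eq {i j : ℕ} (h : j ≤ d + 1) :
    Φ.η i j = rootProd (fun n => Φ.eigenvalue (d - n)) i j := by
  simp only [η, ← eigenvalue_sub]
  rw [Finset.prod_filter, Fin.prod_univ_eq_prod_range (fun h => if i ≤ h ∧ h < j then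
    X - C (Φ.eigenvalue (d - h)) else 1) (d + 1), ← Finset.prod_filter, rootProd]
  refine Finset.prod_congr (Finset.ext fun h => ?_) fun _ _ => rfl
  simp only [Finset.mem_filter, Finset.mem_range, Finset.mem_Ico]
  omega

theorem vartheta_eq {i : ℕ} (h : i ≤ d + 1) : Φ.vartheta i =
    reflectedSum Φ.eigenvalue d i / (Φ.eigenvalue 0 - Φ.eigenvalue d) := by
  have h0 : Φ.eigenvalue 0 = Φ.θ 0 := Φ.eigenvalue_val 0
  have hl : Φ.eigenvalue d = Φ.θ (Fin.last d) := Φ.eigenvalue_val (Fin.last d)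
  rw [vartheta, ← Finset.sum_div, ← h0, ← hl]
  simp only [← eigenvalue_sub]
  simp only [← eigenvalue_val]
  rw [Finset.sum_filter, Fin.sum_univ_eq_sum_range (fun h => if h < i then
    Φ.eigenvalue h - Φ.eigenvalue (d - h) else 0) (d + 1), ← Finset.sum_filter, reflectedSum]
  congr 1
  refine Finset.sum_congr (Finset.ext fun h => ?_) fun _ _ => rfl
  simp only [Finset.mem_filter, Finset.mem_range]
  omega

variable {Φ} {θs : ℕ → K} (D : IsTridiagonalData Φ.A Φ.Astar d Φ.eigenvalue θs)
  (hs : ∀ i, LinearMap.range (Φ.Estar i) = Φ.Astar.eigenspace (θs i))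

section
include D hs

theorem U_eq : Φ.U = fun i : Fin (d + 1) => splitComponent Φ.A Φ.Astar d Φ.eigenvalue θs i := by
  funext i
  have := i.2
  rw [U, splitComponent, D.right.iSup_eq_spectralSum hs (a := 0) (b := i + 1) (by omega)
    fun j => by rw [Fin.le_def]; omega, D.left.iSup_eq_spectralSum Φ.range_E_eq (a := i)
    (b := d + 1) le_rfl fun j => by rw [Fin.le_def]; omega]

theorem Udown_eq : Φ.Udown = fun i : Fin (d + 1) =>
    splitComponent Φ.A Φ.Astar d (fun n => Φ.eigenvalue (d - n)) θs i := by
  funext i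
  have := i.2
  rw [Udown, splitComponent, D.right.iSup_eq_spectralSum hs (a := 0) (b := i + 1) (by omega)
    fun j => by rw [Fin.le_def]; omega, D.left.iSup_eq_spectralSum Φ.range_E_eq (a := 0)
    (b := d + 1 - i) (by omega) fun j => by rw [Fin.le_def, Fin.val_rev]; omega]
  congr 1
  rw [spectralSum, spectralSum, rootProd_reflect _ le_rfl, Nat.sub_self]

theorem Ksub_eq {i : ℕ} (hi : i ≤ d) :
    Φ.Ksub i = splitKernel Φ.A Φ.Astar d Φ.eigenvalue θs i := by
  rw [Ksub, splitKernel, D.right.iSup_eq_spectralSum hs (a := 0) (b := i + 1) (by omega)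
    fun j => by omega, D.left.iSup_eq_spectralSum Φ.range_E_eq (a := i)
    (b := d + 1 - i) (by omega) fun j => by omega]

theorem isPsi_iff (P : Module.End K V) :
    Φ.IsPsi P ↔
      IsTridiagonalData.IsLowering Φ.A Φ.Astar d Φ.eigenvalue θs Φ.vartheta P := by
  refine forall₄_congr fun i j hij hd => ?_
  rw [Ksub_eq D hs (by omega), τ_eq Φ (by omega), τ_eq Φ (by omega)]

theorem existsUnique_isPsi [FiniteDimensional K V] : ∃! P : Module.End K V, Φ.IsPsi P := by
  obtain ⟨P, hP⟩ := D.exists_linearMap fun i j =>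
    (Φ.vartheta j - Φ.vartheta i) • aeval Φ.A (rootProd Φ.eigenvalue i (j - 1))
  refine ⟨P, (isPsi_iff D hs P).2 hP, fun Q hQ => D.linearMap_ext fun i j hij hd v hv => ?_⟩
  rw [(isPsi_iff D hs Q).1 hQ i j hij hd v hv, hP i j hij hd v hv, LinearMap.smul_apply]

theorem isPsi_Ψ [FiniteDimensional K V] : Φ.IsPsi Φ.Ψ := by
  have h := (existsUnique_isPsi D hs).exists
  rw [Ψ, dif_pos h]
  exact h.choose_spec

end

include D in
theorem vartheta_ne_zero (hd : 1 ≤ d) {β : K} (hβ : Φ.IsBase β)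
    (hcase : (β ≠ 2 ∧ β ≠ -2) ∨ (β = 2 ∧ ringChar K ≠ 2) ∨ (β = -2 ∧ ringChar K ≠ 2 ∧ Even d))
    {i : ℕ} (hi : 1 ≤ i) (hid : i ≤ d) : Φ.vartheta i ≠ 0 := by
  have hne : ∀ i j, i ≤ d → j ≤ d → i ≠ j → Φ.eigenvalue i - Φ.eigenvalue j ≠ 0 :=
    fun i j hi hj h => sub_ne_zero.2 fun e => h (D.left.injOn hi hj e)
  obtain ⟨β', γ, hrec⟩ := D.exists_recurrence
  rw [Φ.vartheta_eq (by omega)]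
  refine div_ne_zero ?_ (hne 0 d (by omega) le_rfl (by omega))
  -- For d ≤ 2 the given β is unrelated to the recurrence; d = 1 is immediate, and d = 2 is even.
  -- For d ≥ 3 subtracting two instances of the recurrence identifies β with β'.
  rcases lt_or_ge d 3 with h3 | h3
  · obtain rfl | rfl : d = 1 ∨ d = 2 := by omega
    · obtain rfl : i = 1 := by omega
      rw [reflectedSum_succ, reflectedSum_zero, zero_add, Nat.sub_zero]
      exact hne 0 1 (by omega) le_rfl (by omega)
    · exact reflectedSum_ne_zero hrec D.left.injOn (Or.inl even_two) hi hid
  · refine reflectedSum_ne_zero hrec D.left.injOn ?_ hi hid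
    have e : ∀ n (h : n < d + 1), Φ.θ ⟨n, h⟩ = Φ.eigenvalue n := fun n h =>
      (Φ.eigenvalue_val ⟨n, h⟩).symm
    have hb := hβ.1 h3
    have e0 : Φ.θ 0 = Φ.eigenvalue 0 := (Φ.eigenvalue_val 0).symm
    rw [e 3, e 1, e 2, e0, eq_div_iff (hne 1 2 (by omega) (by omega) (by omega))] at hb
    have hββ : β = β' := by
      have h₁ := hrec 0 (by omega)
      have h₂ := hrec 1 (by omega)
      refine mul_right_cancel₀ (hne 1 2 (by omega) (by omega) (by omega)) ?_
      linear_combination hb + h₁ - h₂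
    rw [← hββ]
    rcases hcase with ⟨_, h⟩ | ⟨rfl, h⟩ | ⟨_, _, h⟩
    · exact Or.inr fun h0 => h (eq_neg_of_add_eq_zero_left h0)
    · have h2 : (2 : K) ≠ 0 := Ring.two_ne_zero h
      refine Or.inr ?_
      rw [show (2 : K) + 2 = 2 * 2 by norm_num]
      exact mul_ne_zero h2 h2
    · exact Or.inl h

include D in
theorem vartheta_identity {a t : ℕ} (hat : a + t ≤ d) :
    (Φ.eigenvalue a - Φ.eigenvalue (d - a - t)) * Φ.vartheta (t + 1) =
      (Φ.eigenvalue 0 - Φ.eigenvalue (d - t)) * (Φ.vartheta (a + t + 1) - Φ.vartheta a) := by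
  obtain ⟨β, γ, hrec⟩ := D.exists_recurrence
  rw [Φ.vartheta_eq (by omega), Φ.vartheta_eq (by omega), Φ.vartheta_eq (by omega), ← sub_div,
    mul_div_assoc', mul_div_assoc', sub_mul_reflectedSum hrec hat]

-- Reversing the eigenvalues negates every partial sum, and the sign cancels between the two sides.
include D in
theorem vartheta_identity_reverse {a t : ℕ} (hat : a + t ≤ d) :
    (Φ.eigenvalue (d - a) - Φ.eigenvalue (d - (d - a - t))) * Φ.vartheta (t + 1) =
      (Φ.eigenvalue (d - 0) - Φ.eigenvalue (d - (d - t))) *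
        (Φ.vartheta (a + t + 1) - Φ.vartheta a) := by
  obtain ⟨β, γ, hrec⟩ := D.exists_recurrence
  have h := sub_mul_reflectedSum (reverse_recurrence hrec) hat
  rw [reflectedSum_reverse _ (by omega), reflectedSum_reverse _ (by omega),
    reflectedSum_reverse _ (by omega)] at h
  rw [Φ.vartheta_eq (by omega), Φ.vartheta_eq (by omega), Φ.vartheta_eq (by omega), ← sub_div,
    mul_div_assoc', mul_div_assoc']
  congr 1
  linear_combination -h

section
include D hs

theorem Δ_apply (hne : ∀ i, 1 ≤ i → i ≤ d → Φ.vartheta i ≠ 0) {i j : ℕ} (hij : i ≤ j)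
    (hd : i + j ≤ d) {v : V} (hv : v ∈ splitKernel Φ.A Φ.Astar d Φ.eigenvalue θs i) :
    Φ.Δ (aeval Φ.A (rootProd Φ.eigenvalue i j) v) =
      aeval Φ.A (rootProd (fun n => Φ.eigenvalue (d - n)) i j) v := by
  refine D.sum_projection_apply (fun a t => vartheta_identity_reverse D) hne ?_ ?_ hij hd hv
  · intro i j x hx
    rw [F, U_eq D hs]
    exact componentProjection_apply D.isInternal_splitComponent i j hx
  · intro i j x hx
    rw [Fdown, Udown_eq D hs]
    exact componentProjection_apply D.reverse.isInternal_splitComponent i j hx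

theorem Δ_eq [FiniteDimensional K V] (hne : ∀ i, 1 ≤ i → i ≤ d → Φ.vartheta i ≠ 0) :
    Φ.Δ = ∑ k ∈ Finset.range (d + 1),
        ((Φ.η 0 k).eval (Φ.θ 0) / ∏ i ∈ Finset.Icc 1 k, Φ.vartheta i) • Φ.Ψ ^ k := by
  have hP := (isPsi_iff D hs _).1 (isPsi_Ψ D hs)
  have hcoeff : ∀ k ∈ Finset.range (d + 1),
      ((Φ.η 0 k).eval (Φ.θ 0) / ∏ i ∈ Finset.Icc 1 k, Φ.vartheta i) • Φ.Ψ ^ k =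
      ladderCoeff Φ.eigenvalue Φ.vartheta d k • Φ.Ψ ^ k := by
    intro k hk
    rw [Φ.η_eq (Finset.mem_range.1 hk).le, ladderCoeff, ← Φ.eigenvalue_val 0, Fin.val_zero]
  rw [Finset.sum_congr rfl hcoeff]
  refine D.linearMap_ext fun i j hij hd v hv => ?_
  rw [Δ_apply D hs hne hij hd hv,
    hP.sum_pow_apply (fun a t => vartheta_identity D) hne hij hd hv]

/-- Since Ψ also lowers the reversed ladders, this polynomial in Ψ sends η_{ij}(A)v back to
τ_{ij}(A)v and so undoes Δ. -/
theorem Δ_inverse_mul [FiniteDimensional K V] (hne : ∀ i, 1 ≤ i → i ≤ d → Φ.vartheta i ≠ 0) :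
    (∑ k ∈ Finset.range (d + 1), ((Φ.τ 0 k).eval (Φ.θ (Fin.last d)) /
        ∏ i ∈ Finset.Icc 1 k, Φ.vartheta i) • Φ.Ψ ^ k) * Φ.Δ = 1 := by
  have hP := ((isPsi_iff D hs _).1 (isPsi_Ψ D hs)).reverse (fun a t => vartheta_identity D) hne
  have hcoeff : ∀ k ∈ Finset.range (d + 1),
      ((Φ.τ 0 k).eval (Φ.θ (Fin.last d)) / ∏ i ∈ Finset.Icc 1 k, Φ.vartheta i) • Φ.Ψ ^ k =
      ladderCoeff (fun n => Φ.eigenvalue (d - n)) Φ.vartheta d k • Φ.Ψ ^ k := by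
    intro k hk
    rw [Φ.τ_eq (Finset.mem_range.1 hk).le, ladderCoeff, ← Φ.eigenvalue_val (Fin.last d),
      Fin.val_last, rootProd_reverse_reverse _ (Finset.mem_range.1 hk).le, Nat.sub_zero]
  rw [Finset.sum_congr rfl hcoeff]
  refine D.linearMap_ext fun i j hij hd v hv => ?_
  rw [Module.End.mul_apply, Δ_apply D hs hne hij hd hv,
    hP.sum_pow_apply (fun a t => vartheta_identity_reverse D) hne hij hd
      (by rwa [IsTridiagonalData.splitKernel_reverse]),
    rootProd_reverse_reverse _ (by omega), Module.End.one_apply]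

end

include D in
theorem eval_η_ne_zero : (Φ.η 0 d).eval (Φ.θ 0) ≠ 0 := by
  rw [Φ.η_eq (Nat.le_succ d), ← Φ.eigenvalue_val 0, rootProd, eval_prod, Finset.prod_ne_zero_iff]
  intro h hh
  rw [Finset.mem_Ico] at hh
  rw [eval_sub, eval_X, eval_C, sub_ne_zero]
  intro e
  have := D.left.injOn (by simp) (by simp) e
  simp only [Fin.val_zero] at this
  omega

include D in
theorem eval_τ_ne_zero : (Φ.τ 0 d).eval (Φ.θ (Fin.last d)) ≠ 0 := by
  rw [Φ.τ_eq (Nat.le_succ d), ← Φ.eigenvalue_val, rootProd, eval_prod, Finset.prod_ne_zero_iff]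
  intro h hh
  rw [Finset.mem_Ico] at hh
  rw [eval_sub, eval_X, eval_C, sub_ne_zero]
  intro e
  have := D.left.injOn (by simp) (by simp only [Set.mem_Iic]; omega) e
  simp only [Fin.val_last] at this
  omega

end TDSystem

theorem exists_polynomial_degree_eq {K R : Type*} [Field K] [Ring R] [Algebra K R] (x : R)
    (c : ℕ → K) {d : ℕ} (hc : c d ≠ 0) :
    ∃ p : K[X], p.degree = d ∧ aeval x p = ∑ k ∈ Finset.range (d + 1), c k • x ^ k := by
  refine ⟨∑ k ∈ Finset.range (d + 1), C (c k) * X ^ k, ?_, ?_⟩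
  · refine le_antisymm ((degree_sum_le _ _).trans (Finset.sup_le fun k hk => ?_))
      (le_degree_of_ne_zero ?_)
    · exact (degree_C_mul_X_pow_le _ _).trans
        (Nat.cast_le.2 (Nat.lt_succ_iff.1 (Finset.mem_range.1 hk)))
    · simpa [finsetSum_coeff, coeff_C_mul, coeff_X_pow] using hc
  · simp [map_sum, Algebra.smul_def]

theorem mainTheorem2 {K V : Type*} [Field K] [AddCommGroup V] [Module K V]
    [FiniteDimensional K V] [Nontrivial V] {d : ℕ} (hd : 1 ≤ d) (Φ : TDSystem K V d) :
    -- the maps `Δ` and `Ψ` are well defined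
    (DirectSum.IsInternal Φ.U ∧ DirectSum.IsInternal Φ.Udown ∧
      (∃! P : Module.End K V, Φ.IsPsi P) ∧ Φ.IsPsi Φ.Ψ) ∧
    -- the three cases on the base `β` in which all `ϑ_i` are nonzero
    (∀ β : K, Φ.IsBase β →
      ((β ≠ 2 ∧ β ≠ -2) ∨ (β = 2 ∧ ringChar K ≠ 2) ∨ (β = -2 ∧ ringChar K ≠ 2 ∧ Even d)) →
      ∀ i : ℕ, 1 ≤ i → i ≤ d → Φ.vartheta i ≠ 0) ∧
    -- the polynomial formulas
    ((∀ i : ℕ, 1 ≤ i → i ≤ d → Φ.vartheta i ≠ 0) →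
      Φ.Δ = ∑ k ∈ Finset.range (d + 1),
        ((Φ.η 0 k).eval (Φ.θ 0) / ∏ i ∈ Finset.Icc 1 k, Φ.vartheta i) • Φ.Ψ ^ k ∧
      IsUnit Φ.Δ ∧
      Ring.inverse Φ.Δ = ∑ k ∈ Finset.range (d + 1),
        ((Φ.τ 0 k).eval (Φ.θ (Fin.last d)) / ∏ i ∈ Finset.Icc 1 k, Φ.vartheta i) • Φ.Ψ ^ k ∧
      (∃ p : K[X], p.degree = d ∧ aeval Φ.Ψ p = Φ.Δ) ∧
      (∃ p : K[X], p.degree = d ∧ aeval Φ.Ψ p = Ring.inverse Φ.Δ)) := by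
  obtain ⟨θs, D, hs⟩ := Φ.exists_isTridiagonalData
  refine ⟨⟨?_, ?_, TDSystem.existsUnique_isPsi D hs, TDSystem.isPsi_Ψ D hs⟩,
    fun β hβ hcase i hi hid => TDSystem.vartheta_ne_zero D hd hβ hcase hi hid, fun hne => ?_⟩
  · rw [TDSystem.U_eq D hs]
    exact D.isInternal_splitComponent
  · rw [TDSystem.Udown_eq D hs]
    exact D.reverse.isInternal_splitComponent
  have hΔ := TDSystem.Δ_eq D hs hne
  have hmul := TDSystem.Δ_inverse_mul D hs hne
  -- In finite dimension a left inverse is two-sided.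
  have hmul' := mul_eq_one_comm.1 hmul
  have hinv : Ring.inverse Φ.Δ = _ := Ring.inverse_unit ⟨Φ.Δ, _, hmul', hmul⟩
  have hprod : ∏ i ∈ Finset.Icc 1 d, Φ.vartheta i ≠ 0 := Finset.prod_ne_zero_iff.2 fun i hi =>
    hne i (Finset.mem_Icc.1 hi).1 (Finset.mem_Icc.1 hi).2
  refine ⟨hΔ, ⟨⟨Φ.Δ, _, hmul', hmul⟩, rfl⟩, hinv, ?_, ?_⟩
  · rw [hΔ]
    exact exists_polynomial_degree_eq _ _ (div_ne_zero (TDSystem.eval_η_ne_zero D) hprod)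
  · rw [hinv]
    exact exists_polynomial_degree_eq _ _ (div_ne_zero (TDSystem.eval_τ_ne_zero D) hprod)
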